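/- There is an integer $N$ such that the following hold for every $n \ge N$. (1) Let $d > n^{-1/200}$ be real, and let the complete bipartite graph $K_{n,n}$ be properly edge-coloured (distinct edges sharing a vertex receive distinct colours) so that at least $dn^2$ colours are used. Then there is a rainbow perfect matching, that is, a perfect matching of $K_{n,n}$ whose edges have pairwise distinct colours. (2) Call an $n \times n$ array filled with symbols a Latin array of order $n$ if every symbol appears at most once in each row and at most once in each column, and call a set of cells a transversal if it contains exactly one cell from each row, exactly one cell from each column, and no two cells with the same symbol. Every Latin array of order $n$ in which at least $n^{399/200}$ distinct symbols appear has a transversal. (3) In particular (the Akbari–Alipour conjecture for large $n$), every Latin array of order $n$ in which at least $n^2/2$ distinct symbols appear has a transversal. -/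

import Mathlib

/-- A perfect matching of `G` all of whose edges receive pairwise distinct colours. A proper
edge-colouring of `G` is a proper vertex-colouring of its line graph: distinct edges that share
an endpoint receive distinct colours. -/
def IsRainbowPerfectMatching {V α : Type*} {G : SimpleGraph V} (c : G.lineGraph.Coloring α)
    (M : G.Subgraph) : Prop :=
  M.IsPerfectMatching ∧ Set.InjOn c {e : G.edgeSet | (e : Sym2 V) ∈ M.edgeSet}

/-- A Latin array of order `n`: an `n × n` array in which every symbol appears at most once in
each row and at most once in each column. -/
def IsLatinArray {n : ℕ} {α : Type*} (L : Matrix (Fin n) (Fin n) α) : Prop :=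
  (∀ i, Function.Injective fun j => L i j) ∧ (∀ j, Function.Injective fun i => L i j)

/-- The set of symbols that occur in an array. -/
def arraySymbols {n : ℕ} {α : Type*} (L : Matrix (Fin n) (Fin n) α) : Set α :=
  Set.range fun p : Fin n × Fin n => L p.1 p.2

/-- A transversal: a set of cells that uses every row exactly once and every column exactly once,
with no symbol repeated. -/
def IsTransversal {n : ℕ} {α : Type*} (L : Matrix (Fin n) (Fin n) α)
    (T : Set (Fin n × Fin n)) : Prop :=
  (∀ i, ∃! j, (i, j) ∈ T) ∧ (∀ j, ∃! i, (i, j) ∈ T) ∧ Set.InjOn (fun p => L p.1 p.2) T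

/-! All three statements reduce to `exists_perfect_rainbow`: a properly coloured n × n square with
at least dn² colours has a perfect rainbow matching when n is large against a power of 1/d. A
switching argument gives a rainbow matching that is nearly perfect; the surplus of colours serves to
complete it.

The colours are split. A random set U of density μ, of order d², is kept in reserve; fourth moments
show that every row, column and large rectangle contains about the expected number of cells with
colours of U (`exists_isReserve`). Outside U, an average argument leaves about dn² colours with
O(1/d) cells each, and one cell per such colour gives a dense set H of cells, all of different
colours. In H there is a matching M₀ covering row set X and column set Y, with many cells of H
joining each row of X to Y (`exists_linked_matching`).

Let M be a rainbow matching avoiding U, N its part outside M₀ and P its part in M₀. With N alone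
switched (`exists_augmentations`), N can be made to cover one more column, to be chosen among nearly
n − |N| columns. If no such column is free in M, nearly all columns of P can be reached; reaching y
frees the row x which P matches to y. The mirror argument frees a column y' in the same way. Since
so many choices are available, (x, y') can be taken in H with an unused colour, and M grows by one
cell (`IsLinkedSystem.exists_augmentation`). Rare colours matter because colours that must not
appear then occupy few cells in most rows. The gain continues until only O(1/(dμ)) rows are missing.

The reserve completes this matching: a free row and a free column are absorbed by deleting two cells
of M and adding three cells with unused colours of U, which the rectangle estimate supplies
(`exists_augmentation_of_expander`). The few steps needed hardly consume U. -/

section RainbowMatchings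

open Finset

set_option linter.unusedSectionVars false

/-- A set of cells no two of which share a row, a column or a colour. -/
def IsRainbow {A B α : Type*} (c : A × B → α) (M : Finset (A × B)) : Prop :=
  ∀ p ∈ M, ∀ q ∈ M, p.1 = q.1 ∨ p.2 = q.2 ∨ c p = c q → p = q

/-! ### Elementary operations on rainbow matchings. -/

namespace IsRainbow

variable {A B α : Type*} {c : A × B → α} {M N : Finset (A × B)}

lemma mono (h : IsRainbow c M) (hNM : N ⊆ M) : IsRainbow c N :=
  fun p hp q hq => h p (hNM hp) q (hNM hq)

lemma injOn_fst (h : IsRainbow c M) : Set.InjOn Prod.fst (M : Set (A × B)) :=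
  fun p hp q hq e => h p hp q hq (Or.inl e)

lemma injOn_snd (h : IsRainbow c M) : Set.InjOn Prod.snd (M : Set (A × B)) :=
  fun p hp q hq e => h p hp q hq (Or.inr (Or.inl e))

lemma injOn_color (h : IsRainbow c M) : Set.InjOn c (M : Set (A × B)) :=
  fun p hp q hq e => h p hp q hq (Or.inr (Or.inr e))

variable [DecidableEq A] [DecidableEq B] [DecidableEq α]

lemma card_image_fst (h : IsRainbow c M) : #(M.image Prod.fst) = #M :=
  card_image_of_injOn h.injOn_fst

lemma card_image_snd (h : IsRainbow c M) : #(M.image Prod.snd) = #M :=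
  card_image_of_injOn h.injOn_snd

lemma card_image_color (h : IsRainbow c M) : #(M.image c) = #M :=
  card_image_of_injOn h.injOn_color

lemma insert {p : A × B} (h : IsRainbow c M) (h₁ : p.1 ∉ M.image Prod.fst)
    (h₂ : p.2 ∉ M.image Prod.snd) (h₃ : c p ∉ M.image c) : IsRainbow c (insert p M) := by
  simp only [mem_image, not_exists, not_and] at h₁ h₂ h₃
  intro x hx y hy hxy
  rw [mem_insert] at hx hy
  rcases hx with rfl | hx <;> rcases hy with rfl | hy
  · rfl
  · rcases hxy with e | e | e
    · exact absurd e.symm (h₁ y hy)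
    · exact absurd e.symm (h₂ y hy)
    · exact absurd e.symm (h₃ y hy)
  · rcases hxy with e | e | e
    · exact absurd e (h₁ x hx)
    · exact absurd e (h₂ x hx)
    · exact absurd e (h₃ x hx)
  · exact h x hx y hy hxy

lemma union (hM : IsRainbow c M) (hN : IsRainbow c N)
    (h₁ : Disjoint (M.image Prod.fst) (N.image Prod.fst))
    (h₂ : Disjoint (M.image Prod.snd) (N.image Prod.snd))
    (h₃ : Disjoint (M.image c) (N.image c)) : IsRainbow c (M ∪ N) := by
  have key : ∀ x ∈ M, ∀ y ∈ N, ¬ (x.1 = y.1 ∨ x.2 = y.2 ∨ c x = c y) := by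
    rintro x hx y hy (e | e | e)
    · exact disjoint_left.1 h₁ (mem_image_of_mem _ hx) (e ▸ mem_image_of_mem _ hy)
    · exact disjoint_left.1 h₂ (mem_image_of_mem _ hx) (e ▸ mem_image_of_mem _ hy)
    · exact disjoint_left.1 h₃ (mem_image_of_mem _ hx) (e ▸ mem_image_of_mem _ hy)
  intro x hx y hy hxy
  rw [mem_union] at hx hy
  rcases hx with hx | hx <;> rcases hy with hy | hy
  · exact hM x hx y hy hxy
  · exact absurd hxy (key x hx y hy)
  · refine absurd ?_ (key y hy x hx)
    rcases hxy with e | e | e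
    exacts [Or.inl e.symm, Or.inr (Or.inl e.symm), Or.inr (Or.inr e.symm)]
  · exact hN x hx y hy hxy

lemma fst_notMem_image_erase {p : A × B} (h : IsRainbow c M) (hp : p ∈ M) :
    p.1 ∉ (M.erase p).image Prod.fst := by
  simp only [mem_image, mem_erase, not_exists, not_and, and_imp]
  exact fun q hq hqM e => hq (h.injOn_fst hqM hp e)

lemma snd_notMem_image_erase {p : A × B} (h : IsRainbow c M) (hp : p ∈ M) :
    p.2 ∉ (M.erase p).image Prod.snd := by
  simp only [mem_image, mem_erase, not_exists, not_and, and_imp]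
  exact fun q hq hqM e => hq (h.injOn_snd hqM hp e)

lemma color_notMem_image_erase {p : A × B} (h : IsRainbow c M) (hp : p ∈ M) :
    c p ∉ (M.erase p).image c := by
  simp only [mem_image, mem_erase, not_exists, not_and, and_imp]
  exact fun q hq hqM e => hq (h.injOn_color hqM hp e)

lemma image_swap (h : IsRainbow c M) :
    IsRainbow (fun p : B × A => c p.swap) (M.image Prod.swap) := by
  simp only [IsRainbow, mem_image]
  rintro _ ⟨p, hp, rfl⟩ _ ⟨q, hq, rfl⟩ hpq
  simp only [Prod.swap_swap, Prod.fst_swap, Prod.snd_swap] at hpq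
  rw [h p hp q hq (by tauto)]

end IsRainbow

/-! ### Switching along uncovered rows. -/

section Chain

variable {A B α : Type*} [DecidableEq A] [DecidableEq B] [DecidableEq α]

/-- `N'` arises from the rainbow matching `N` by augmentation: it covers in addition the column `y`
and a row of `D`, and has at most one new colour, which lies outside `Z`. -/
structure IsAugmentation (c : A × B → α) (N : Finset (A × B)) (D : Finset A) (Z : Finset α) (y : B)
    (N' : Finset (A × B)) : Prop where
  rainbow : IsRainbow c N'
  card_eq : #N' = #N + 1
  rows : N'.image Prod.fst ⊆ N.image Prod.fst ∪ D
  cols : N'.image Prod.snd = insert y (N.image Prod.snd)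
  colors : ∃ u ∉ Z, N'.image c ⊆ insert u (N.image c)

/-- The cell `e` of `N` can be freed by a switching that uses rows of `D` and moves only cells
of `F`. -/
def IsFreeable (c : A × B → α) (N : Finset (A × B)) (D : Finset A) (Z : Finset α)
    (F : Finset (A × B)) (e : A × B) : Prop :=
  ∃ N', IsRainbow c N' ∧ #N' = #N ∧ N'.image Prod.fst ⊆ N.image Prod.fst ∪ D ∧
    N'.image Prod.snd = N.image Prod.snd ∧ N \ N' ⊆ F ∧ c e ∉ N'.image c ∧
    ∃ u ∉ Z, N'.image c ⊆ insert u (N.image c)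

lemma IsFreeable.mono {c : A × B → α} {N : Finset (A × B)} {D D' : Finset A} {Z : Finset α}
    {F F' : Finset (A × B)} {e : A × B} (h : IsFreeable c N D Z F e) (hD : D ⊆ D') (hF : F ⊆ F') :
    IsFreeable c N D' Z F' e := by
  obtain ⟨N', h1, h2, h3, h4, h5, h6, h7⟩ := h
  exact ⟨N', h1, h2, h3.trans (union_subset_union_right hD), h4, h5.trans hF, h6, h7⟩

/-- The switching argument of Woolbright and of Brouwer, de Vries and Wieringa. -/
theorem exists_augmentations [Fintype B] {c : A × B → α}
    (hrow : ∀ a b b', c (a, b) = c (a, b') → b = b') {N : Finset (A × B)} (hN : IsRainbow c N)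
    {D : Finset A} (hD : Disjoint D (N.image Prod.fst)) {Z : Finset α} {t g : ℕ}
    (hZ : ∀ a ∈ D, #{b | c (a, b) ∈ Z} ≤ t) (hcard : #N < #D * g) :
    ∃ S : Finset B, Fintype.card B ≤ #S + t + #N + g ∧ ∀ y ∈ S, y ∉ N.image Prod.snd ∧
      ∃ N', IsAugmentation c N D Z y N' := by
  by_contra hcon
  -- If too few columns can be reached, each further row of D makes g more cells of N freeable; with
  -- all of D there would be more freeable cells than N has.
  suffices h : ∀ D' ⊆ D, ∃ F ⊆ N, #D' * g ≤ #F ∧ ∀ e ∈ F, IsFreeable c N D' Z F e by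
    obtain ⟨F, hF, h1, -⟩ := h D subset_rfl
    exact absurd (card_le_card hF) (by omega)
  intro D'
  induction D' using Finset.induction_on with
  | empty => exact fun _ => ⟨∅, by simp, by simp, by simp⟩
  | insert a D' ha ih =>
    intro hDD
    have haD : a ∈ D := hDD (mem_insert_self _ _)
    have hD'D : D' ⊆ D := (subset_insert _ _).trans hDD
    obtain ⟨F, hFN, hFcard, hF⟩ := ih hD'D
    have haN : a ∉ N.image Prod.fst ∪ D' := by
      rw [mem_union]; exact fun h => h.elim (disjoint_left.1 hD haD) ha
    -- The columns b where (a, b) has a colour outside Z that is either absent from N or carried by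
    -- a freeable cell.
    set V : Finset B := {b | c (a, b) ∉ Z ∧ c (a, b) ∉ (N \ F).image c} with hV
    have hVcard : Fintype.card B + #F ≤ #V + t + #N := by
      have h1 : #{b | c (a, b) ∈ (N \ F).image c} ≤ #N - #F := by
        rw [← card_sdiff_of_subset hFN]
        refine le_trans ?_ (card_image_le (s := N \ F) (f := c))
        exact card_le_card_of_injOn (fun b => c (a, b)) (fun b hb => by simpa using hb)
          (fun b _ b' _ h => hrow a b b' h)
      have h2 := card_le_card hFN
      have h3 : (univ : Finset B) ⊆ V ∪ ({b | c (a, b) ∈ Z} : Finset B) ∪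
          ({b | c (a, b) ∈ (N \ F).image c} : Finset B) := by
        intro b _
        simp only [hV, mem_union, mem_filter, mem_univ, true_and]
        tauto
      have h4 := (card_le_card h3).trans (card_union_le _ _)
      have h5 := card_union_le V ({b | c (a, b) ∈ Z} : Finset B)
      have h6 := hZ a haD
      rw [card_univ] at h4
      omega
    -- The colour of (a, b) can be made available: by freeing its cell in N, or with N unchanged if
    -- the colour is new. Only one of the two cases brings in a new colour, so at most one arises in
    -- all.
    have hbase : ∀ b ∈ V, ∃ N₀, IsRainbow c N₀ ∧ #N₀ = #N ∧
        N₀.image Prod.fst ⊆ N.image Prod.fst ∪ D' ∧ N₀.image Prod.snd = N.image Prod.snd ∧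
        N \ N₀ ⊆ F ∧ c (a, b) ∉ N₀.image c ∧
        ∃ u ∉ Z, insert (c (a, b)) (N₀.image c) ⊆ insert u (N.image c) := by
      intro b hb
      simp only [hV, mem_filter, mem_univ, true_and] at hb
      by_cases hcN : c (a, b) ∈ N.image c
      · obtain ⟨e, he, hec⟩ := mem_image.1 hcN
        have heF : e ∈ F := by
          by_contra heF
          exact hb.2 (mem_image.2 ⟨e, mem_sdiff.2 ⟨he, heF⟩, hec⟩)
        obtain ⟨N', h1, h2, h3, h4, h5, h6, u, hu, h7⟩ := hF e heF
        refine ⟨N', h1, h2, h3, h4, h5, hec ▸ h6, u, hu, insert_subset ?_ h7⟩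
        exact mem_insert_of_mem hcN
      · exact ⟨N, hN, rfl, subset_union_left, rfl, by simp, hcN, c (a, b), hb.1, subset_rfl⟩
    have hsmall : #(V \ N.image Prod.snd) + t + #N + g < Fintype.card B := by
      by_contra hge
      push Not at hge
      refine hcon ⟨V \ N.image Prod.snd, hge, fun y hy => ?_⟩
      rw [mem_sdiff] at hy
      refine ⟨hy.2, ?_⟩
      obtain ⟨N₀, h1, h2, h3, h4, h5, h6, u, hu, h7⟩ := hbase y hy.1
      have ha0 : a ∉ N₀.image Prod.fst := fun h => haN (h3 h)
      refine ⟨insert (a, y) N₀, h1.insert ha0 (h4 ▸ hy.2) h6, ?_, ?_, ?_, u, hu, ?_⟩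
      · rw [card_insert_of_notMem, h2]
        exact fun h => ha0 (mem_image_of_mem _ h)
      · rw [image_insert]
        exact insert_subset (mem_union_right _ haD) (h3.trans (union_subset_union_right hD'D))
      · rw [image_insert, h4]
      · rwa [image_insert]
    have hVN : #(V ∩ N.image Prod.snd) ≥ #F + g := by
      have := card_sdiff_add_card_inter V (N.image Prod.snd)
      omega
    set F₁ : Finset (A × B) := {e ∈ N | e.2 ∈ V} with hF₁
    have hF₁card : #F + g ≤ #F₁ := by
      refine hVN.trans ?_
      refine (card_le_card (t := F₁.image Prod.snd) ?_).trans card_image_le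
      intro b hb
      rw [mem_inter, mem_image] at hb
      obtain ⟨hbV, e, he, rfl⟩ := hb
      exact mem_image_of_mem _ (mem_filter.2 ⟨he, hbV⟩)
    refine ⟨F ∪ F₁, union_subset hFN (filter_subset _ _), ?_, ?_⟩
    · rw [card_insert_of_notMem ha, add_mul, one_mul]
      exact (by omega : #D' * g + g ≤ #F + g).trans
        (hF₁card.trans (card_le_card subset_union_right))
    · intro e he
      by_cases heF : e ∈ F
      · exact (hF e heF).mono (subset_insert _ _) subset_union_left
      have heF₁ : e ∈ F₁ := (mem_union.1 he).resolve_left heF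
      obtain ⟨heN, heV⟩ := mem_filter.1 heF₁
      obtain ⟨N₀, h1, h2, h3, h4, h5, h6, u, hu, h7⟩ := hbase e.2 heV
      -- The switching to N₀ moves only cells of F, so e is still there and can be exchanged for the
      -- cell of row a in the same column.
      have heN₀ : e ∈ N₀ := by
        by_contra h
        exact heF (h5 (mem_sdiff.2 ⟨heN, h⟩))
      have ha0 : a ∉ N₀.image Prod.fst := fun h => haN (h3 h)
      have ha1 : a ∉ (N₀.erase e).image Prod.fst :=
        fun h => ha0 (image_subset_image (erase_subset _ _) h)
      have hne : c e ≠ c (a, e.2) := fun h => h6 (h ▸ mem_image_of_mem _ heN₀)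
      refine ⟨insert (a, e.2) (N₀.erase e), ?_, ?_, ?_, ?_, ?_, ?_, u, hu, ?_⟩
      · refine (h1.mono (erase_subset _ _)).insert ha1 (h1.snd_notMem_image_erase heN₀) ?_
        exact fun h => h6 (image_subset_image (erase_subset _ _) h)
      · rw [card_insert_of_notMem (fun h => ha1 (mem_image_of_mem _ h)),
          card_erase_add_one heN₀, h2]
      · rw [image_insert]
        refine insert_subset (mem_union_right _ (mem_insert_self _ _)) ?_
        exact (image_subset_image (erase_subset _ _)).trans
          (h3.trans (union_subset_union_right (subset_insert _ _)))
      · rw [← h4, image_insert]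
        conv_rhs => rw [← insert_erase heN₀, image_insert]
      · intro x hx
        rw [mem_sdiff, mem_insert, mem_erase] at hx
        by_cases hxe : x = e
        · exact hxe ▸ he
        · exact mem_union_left _ (h5 (mem_sdiff.2 ⟨hx.1, fun h => hx.2 (Or.inr ⟨hxe, h⟩)⟩))
      · rw [image_insert, mem_insert, not_or]
        exact ⟨hne, h1.color_notMem_image_erase heN₀⟩
      · rw [image_insert]
        exact (insert_subset_insert _ (image_subset_image (erase_subset _ _))).trans h7

end Chain

/-! ### Fourth moments of a random set of colours. -/

section RandomSubset

variable {α : Type*} [DecidableEq α]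

/-- Expectation over a random subset of `Γ` that contains each element independently with
probability `μ`. -/
noncomputable def randomMean (Γ : Finset α) (μ : ℝ) (F : Finset α → ℝ) : ℝ :=
  ∑ U ∈ Γ.powerset, μ ^ #U * (1 - μ) ^ (#Γ - #U) * F U

/-- The centred indicator of the event that `γ` lies in the random set. -/
noncomputable def centred (μ : ℝ) (U : Finset α) (γ : α) : ℝ := (if γ ∈ U then 1 else 0) - μ

variable {Γ : Finset α} {μ : ℝ}

lemma randomMean_const (C : ℝ) : randomMean Γ μ (fun _ => C) = C := by
  rw [randomMean, ← sum_mul, sum_pow_mul_eq_add_pow]; simp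

lemma randomMean_add (F G : Finset α → ℝ) :
    randomMean Γ μ (fun U => F U + G U) = randomMean Γ μ F + randomMean Γ μ G := by
  simp only [randomMean, mul_add, sum_add_distrib]

lemma randomMean_mul_const (F : Finset α → ℝ) (C : ℝ) :
    randomMean Γ μ (fun U => F U * C) = randomMean Γ μ F * C := by
  simp only [randomMean, sum_mul, mul_assoc]

lemma randomMean_sum {ι : Type*} (s : Finset ι) (F : ι → Finset α → ℝ) :
    randomMean Γ μ (fun U => ∑ i ∈ s, F i U) = ∑ i ∈ s, randomMean Γ μ (F i) := by
  simp only [randomMean, mul_sum]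
  exact sum_comm

lemma randomMean_mono (h₀ : 0 ≤ μ) (h₁ : μ ≤ 1) {F G : Finset α → ℝ} (h : ∀ U ⊆ Γ, F U ≤ G U) :
    randomMean Γ μ F ≤ randomMean Γ μ G :=
  sum_le_sum fun U hU => mul_le_mul_of_nonneg_left (h U (mem_powerset.1 hU))
    (mul_nonneg (pow_nonneg h₀ _) (pow_nonneg (sub_nonneg.2 h₁) _))

lemma exists_le_of_randomMean_le (h₀ : 0 < μ) (h₁ : μ < 1) {F : Finset α → ℝ} {C : ℝ}
    (h : randomMean Γ μ F ≤ C) : ∃ U ⊆ Γ, F U ≤ C := by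
  by_contra! hcon
  have : randomMean Γ μ (fun _ => C) < randomMean Γ μ F :=
    sum_lt_sum_of_nonempty ⟨∅, by simp⟩ fun U hU =>
      mul_lt_mul_of_pos_left (hcon U (mem_powerset.1 hU))
        (mul_pos (pow_pos h₀ _) (pow_pos (sub_pos.2 h₁) _))
  rw [randomMean_const] at this
  linarith

/-- Independence: the sets with and without γ are paired, F agrees on each pair, and the two
weighted values of the centred indicator cancel. -/
lemma randomMean_centred_mul {γ : α} (hγ : γ ∈ Γ) {F : Finset α → ℝ}
    (hF : ∀ U, F (insert γ U) = F U) : randomMean Γ μ (fun U => centred μ U γ * F U) = 0 := by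
  obtain ⟨Δ, hΔ, rfl⟩ : ∃ Δ, γ ∉ Δ ∧ insert γ Δ = Γ :=
    ⟨Γ.erase γ, notMem_erase _ _, insert_erase hγ⟩
  rw [randomMean, sum_powerset_insert hΔ, ← sum_add_distrib]
  refine sum_eq_zero fun U hU => ?_
  have hU' := mem_powerset.1 hU
  have hγU : γ ∉ U := fun h => hΔ (hU' h)
  have h1 := card_le_card hU'
  rw [card_insert_of_notMem hΔ, card_insert_of_notMem hγU, hF, centred, centred,
    if_neg hγU, if_pos (mem_insert_self _ _), Nat.add_sub_add_right,
    Nat.sub_add_comm h1]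
  ring

lemma centred_insert {γ δ : α} (h : δ ≠ γ) (U : Finset α) :
    centred μ (insert γ U) δ = centred μ U δ := by
  simp [centred, mem_insert, h]

lemma abs_centred_le (h₀ : 0 ≤ μ) (h₁ : μ ≤ 1) (U : Finset α) (γ : α) : |centred μ U γ| ≤ 1 := by
  rw [centred, abs_le]; split_ifs <;> constructor <;> linarith

lemma randomMean_card : randomMean Γ μ (fun U => (#U : ℝ)) = μ * #Γ := by
  have h : ∀ γ ∈ Γ, randomMean Γ μ (fun U => if γ ∈ U then 1 else 0) = μ := by
    intro γ hγ
    have h1 := randomMean_centred_mul (μ := μ) hγ (F := fun _ => 1) (fun _ => rfl)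
    have h2 : randomMean Γ μ (fun U => centred μ U γ * 1 + μ) = μ := by
      rw [randomMean_add, h1, randomMean_const, zero_add]
    rw [← h2]
    congr 1; ext U; simp [centred]
  have h2 : randomMean Γ μ (fun U => (#U : ℝ)) =
      randomMean Γ μ (fun U => ∑ γ ∈ Γ, if γ ∈ U then 1 else 0) := by
    refine sum_congr rfl fun U hU => ?_
    congr 1
    change (#U : ℝ) = ∑ γ ∈ Γ, if γ ∈ U then 1 else 0
    rw [sum_boole, filter_mem_eq_inter, inter_eq_right.2 (mem_powerset.1 hU)]
  rw [h2, randomMean_sum, sum_congr rfl h, sum_const, nsmul_eq_mul, mul_comm]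

/-- The four elements fall into two pairs of equal ones. -/
def PairedUp (γ₁ γ₂ γ₃ γ₄ : α) : Prop :=
  (γ₁ = γ₂ ∧ γ₃ = γ₄) ∨ (γ₁ = γ₃ ∧ γ₂ = γ₄) ∨ (γ₁ = γ₄ ∧ γ₂ = γ₃)

instance (γ₁ γ₂ γ₃ γ₄ : α) : Decidable (PairedUp γ₁ γ₂ γ₃ γ₄) := by
  unfold PairedUp; infer_instance

lemma randomMean_four_le (h₀ : 0 ≤ μ) (h₁ : μ ≤ 1) {γ₁ γ₂ γ₃ γ₄ : α} (m₁ : γ₁ ∈ Γ) (m₂ : γ₂ ∈ Γ)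
    (m₃ : γ₃ ∈ Γ) (m₄ : γ₄ ∈ Γ) :
    randomMean Γ μ (fun U => centred μ U γ₁ * centred μ U γ₂ * centred μ U γ₃ * centred μ U γ₄) ≤
      if PairedUp γ₁ γ₂ γ₃ γ₄ then 1 else 0 := by
  split_ifs with h
  · rw [← randomMean_const (Γ := Γ) (μ := μ) 1]
    refine randomMean_mono h₀ h₁ fun U _ => (le_abs_self _).trans ?_
    simp only [abs_mul]
    have := abs_centred_le h₀ h₁ U (α := α)
    exact mul_le_one₀ (mul_le_one₀ (mul_le_one₀ (this _) (abs_nonneg _) (this _)) (abs_nonneg _)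
      (this _)) (abs_nonneg _) (this _)
  · have key : ∀ {δ₁ δ₂ δ₃ δ₄ : α}, δ₁ ∈ Γ → δ₂ ≠ δ₁ → δ₃ ≠ δ₁ → δ₄ ≠ δ₁ →
        randomMean Γ μ (fun U => centred μ U δ₁ *
          (centred μ U δ₂ * centred μ U δ₃ * centred μ U δ₄)) = 0 := by
      intro δ₁ δ₂ δ₃ δ₄ hδ h2 h3 h4
      exact randomMean_centred_mul hδ fun U => by
        rw [centred_insert h2, centred_insert h3, centred_insert h4]
    rw [PairedUp] at h
    -- Four elements that do not pair up include one that differs from the other three, and its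
    -- centred factor kills the mean.
    have hcases : (γ₂ ≠ γ₁ ∧ γ₃ ≠ γ₁ ∧ γ₄ ≠ γ₁) ∨ (γ₁ ≠ γ₂ ∧ γ₃ ≠ γ₂ ∧ γ₄ ≠ γ₂) ∨
        (γ₁ ≠ γ₃ ∧ γ₂ ≠ γ₃ ∧ γ₄ ≠ γ₃) ∨ (γ₁ ≠ γ₄ ∧ γ₂ ≠ γ₄ ∧ γ₃ ≠ γ₄) := by
      grind
    refine le_of_eq ?_
    rcases hcases with ⟨h2, h3, h4⟩ | ⟨h2, h3, h4⟩ | ⟨h2, h3, h4⟩ | ⟨h2, h3, h4⟩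
    · rw [← key m₁ h2 h3 h4]; congr 1; ext U; ring
    · rw [← key m₂ h2 h3 h4]; congr 1; ext U; ring
    · rw [← key m₃ h2 h3 h4]; congr 1; ext U; ring
    · rw [← key m₄ h2 h3 h4]; congr 1; ext U; ring

lemma randomMean_sum_four_le (h₀ : 0 ≤ μ) (h₁ : μ ≤ 1) {ι : Type*} [Fintype ι]
    (f₁ f₂ f₃ f₄ : ι → α)
    (m₁ : ∀ i, f₁ i ∈ Γ) (m₂ : ∀ i, f₂ i ∈ Γ) (m₃ : ∀ i, f₃ i ∈ Γ) (m₄ : ∀ i, f₄ i ∈ Γ) {k : ℕ}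
    (h12 : #{i | f₁ i = f₂ i ∧ f₃ i = f₄ i} ≤ k) (h13 : #{i | f₁ i = f₃ i ∧ f₂ i = f₄ i} ≤ k)
    (h14 : #{i | f₁ i = f₄ i ∧ f₂ i = f₃ i} ≤ k) :
    randomMean Γ μ (fun U => ∑ i, centred μ U (f₁ i) * centred μ U (f₂ i) * centred μ U (f₃ i) *
      centred μ U (f₄ i)) ≤ 3 * k := by
  rw [randomMean_sum]
  refine (sum_le_sum fun i _ => randomMean_four_le h₀ h₁ (m₁ i) (m₂ i) (m₃ i) (m₄ i)).trans ?_
  rw [sum_boole]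
  have : #{i | PairedUp (f₁ i) (f₂ i) (f₃ i) (f₄ i)} ≤ 3 * k := by
    classical
    have hsub : ({i | PairedUp (f₁ i) (f₂ i) (f₃ i) (f₄ i)} : Finset ι) ⊆
        ({i | f₁ i = f₂ i ∧ f₃ i = f₄ i} : Finset ι) ∪ (({i | f₁ i = f₃ i ∧ f₂ i = f₄ i} :
          Finset ι) ∪ ({i | f₁ i = f₄ i ∧ f₂ i = f₃ i} : Finset ι)) := by
      intro i hi
      have h := (mem_filter.1 hi).2
      simp only [mem_union, mem_filter, mem_univ, true_and]
      exact h
    refine (card_le_card hsub).trans ((card_union_le _ _).trans ?_)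
    have := card_union_le ({i | f₁ i = f₃ i ∧ f₂ i = f₄ i} : Finset ι)
      {i | f₁ i = f₄ i ∧ f₂ i = f₃ i}
    omega
  exact_mod_cast this

end RandomSubset

/-! ### The reserve: degrees and rectangle discrepancy. -/

section Moments

variable {A B : Type*} [Fintype A] [Fintype B]

lemma sum_pow_four (f : B → ℝ) :
    (∑ b, f b) ^ 4 = ∑ q : B × B × B × B, f q.1 * f q.2.1 * f q.2.2.1 * f q.2.2.2 := by
  simp only [Fintype.sum_prod_type, mul_assoc, ← mul_sum, ← sum_mul]
  ring

/-- The count of four-cycles weighted by `f`. -/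
noncomputable def cycleSum (f : A → B → ℝ) : ℝ :=
  ∑ q : A × A × B × B, f q.1 q.2.2.1 * f q.2.1 q.2.2.1 * f q.1 q.2.2.2 * f q.2.1 q.2.2.2

lemma cycleSum_eq (f : A → B → ℝ) :
    cycleSum f = ∑ y, ∑ y', (∑ a, f a y * f a y') ^ 2 := by
  simp only [cycleSum, Fintype.sum_prod_type]
  calc _ = ∑ a, ∑ y, ∑ a', ∑ y', f a y * f a' y * f a y' * f a' y' :=
        sum_congr rfl fun a _ => sum_comm
    _ = ∑ y, ∑ a, ∑ a', ∑ y', f a y * f a' y * f a y' * f a' y' := sum_comm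
    _ = ∑ y, ∑ a, ∑ y', ∑ a', f a y * f a' y * f a y' * f a' y' :=
        sum_congr rfl fun y _ => sum_congr rfl fun a _ => sum_comm
    _ = ∑ y, ∑ y', ∑ a, ∑ a', f a y * f a' y * f a y' * f a' y' :=
        sum_congr rfl fun y _ => sum_comm
    _ = _ := by
        refine sum_congr rfl fun y _ => sum_congr rfl fun y' _ => ?_
        rw [sq, sum_mul_sum]
        exact sum_congr rfl fun a _ => sum_congr rfl fun a' _ => by ring

lemma cycleSum_nonneg (f : A → B → ℝ) : 0 ≤ cycleSum f := by
  rw [cycleSum_eq]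
  exact sum_nonneg fun _ _ => sum_nonneg fun _ _ => sq_nonneg _

/-- Cauchy–Schwarz twice, over X and then over Y × Y. The squares that arise are nonnegative, so the
sums may be extended to all rows and all pairs of columns. One bound on `cycleSum` thus controls
every rectangle at once. -/
lemma sum_product_pow_four_le (f : A → B → ℝ) (X : Finset A) (Y : Finset B) :
    (∑ x ∈ X, ∑ y ∈ Y, f x y) ^ 4 ≤ (#X : ℝ) ^ 2 * (#Y : ℝ) ^ 2 * cycleSum f := by
  have h1 : (∑ x ∈ X, ∑ y ∈ Y, f x y) ^ 2 ≤ #X * ∑ y ∈ Y, ∑ y' ∈ Y, ∑ a, f a y * f a y' := by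
    refine sq_sum_le_card_mul_sum_sq.trans (mul_le_mul_of_nonneg_left ?_ (Nat.cast_nonneg _))
    refine (sum_le_sum_of_subset_of_nonneg (subset_univ X) fun _ _ _ => sq_nonneg _).trans ?_
    simp only [sq, sum_mul_sum]
    rw [sum_comm]
    exact le_of_eq (sum_congr rfl fun y _ => sum_comm)
  have h2 : (∑ y ∈ Y, ∑ y' ∈ Y, ∑ a, f a y * f a y') ^ 2 ≤ (#Y : ℝ) ^ 2 * cycleSum f := by
    rw [← sum_product']
    refine sq_sum_le_card_mul_sum_sq.trans ?_
    rw [card_product, Nat.cast_mul, ← sq]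
    refine mul_le_mul_of_nonneg_left ?_ (sq_nonneg _)
    rw [cycleSum_eq, ← sum_product', univ_product_univ]
    exact sum_le_sum_of_subset_of_nonneg (subset_univ _) fun _ _ _ => sq_nonneg _
  calc (∑ x ∈ X, ∑ y ∈ Y, f x y) ^ 4 = ((∑ x ∈ X, ∑ y ∈ Y, f x y) ^ 2) ^ 2 := by ring
    _ ≤ (#X * ∑ y ∈ Y, ∑ y' ∈ Y, ∑ a, f a y * f a y') ^ 2 :=
        pow_le_pow_left₀ (sq_nonneg _) h1 2
    _ = (#X : ℝ) ^ 2 * (∑ y ∈ Y, ∑ y' ∈ Y, ∑ a, f a y * f a y') ^ 2 := by ring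
    _ ≤ (#X : ℝ) ^ 2 * ((#Y : ℝ) ^ 2 * cycleSum f) :=
        mul_le_mul_of_nonneg_left h2 (sq_nonneg _)
    _ = _ := by ring

variable {α : Type*} [DecidableEq α] {Γ : Finset α} {μ : ℝ}

lemma randomMean_row_moment_le (h₀ : 0 ≤ μ) (h₁ : μ ≤ 1) {c : A × B → α} (hΓ : ∀ p, c p ∈ Γ)
    (hrow : ∀ a b b', c (a, b) = c (a, b') → b = b') {n : ℕ} (hA : Fintype.card A = n)
    (hB : Fintype.card B = n) :
    randomMean Γ μ (fun U => ∑ a, (∑ b, centred μ U (c (a, b))) ^ 4) ≤ 3 * (n : ℝ) ^ 3 := by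
  classical
  simp only [sum_pow_four]
  have hcard : Fintype.card (A × B × B) = n ^ 3 := by
    simp only [Fintype.card_prod, hA, hB]; ring
  have h := randomMean_sum_four_le (Γ := Γ) h₀ h₁ (ι := A × B × B × B × B)
    (fun q => c (q.1, q.2.1)) (fun q => c (q.1, q.2.2.1)) (fun q => c (q.1, q.2.2.2.1))
    (fun q => c (q.1, q.2.2.2.2)) (fun _ => hΓ _) (fun _ => hΓ _) (fun _ => hΓ _) (fun _ => hΓ _)
    (k := n ^ 3) ?_ ?_ ?_
  · simp only [Fintype.sum_prod_type] at h ⊢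
    exact_mod_cast h
  · rw [← hcard, ← card_univ]
    refine card_le_card_of_injOn (fun q => (q.1, q.2.1, q.2.2.2.1))
      (fun _ _ => mem_coe.2 (mem_univ _)) ?_
    rintro ⟨a, b1, b2, b3, b4⟩ h ⟨a', b1', b2', b3', b4'⟩ h' e
    simp only [coe_filter, mem_univ, true_and, Set.mem_ofPred_eq, Prod.mk.injEq] at h h' e ⊢
    have := hrow _ _ _ h.1; have := hrow _ _ _ h.2
    have := hrow _ _ _ h'.1; have := hrow _ _ _ h'.2
    grind
  · rw [← hcard, ← card_univ]
    refine card_le_card_of_injOn (fun q => (q.1, q.2.1, q.2.2.1))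
      (fun _ _ => mem_coe.2 (mem_univ _)) ?_
    rintro ⟨a, b1, b2, b3, b4⟩ h ⟨a', b1', b2', b3', b4'⟩ h' e
    simp only [coe_filter, mem_univ, true_and, Set.mem_ofPred_eq, Prod.mk.injEq] at h h' e ⊢
    have := hrow _ _ _ h.1; have := hrow _ _ _ h.2
    have := hrow _ _ _ h'.1; have := hrow _ _ _ h'.2
    grind
  · rw [← hcard, ← card_univ]
    refine card_le_card_of_injOn (fun q => (q.1, q.2.1, q.2.2.1))
      (fun _ _ => mem_coe.2 (mem_univ _)) ?_
    rintro ⟨a, b1, b2, b3, b4⟩ h ⟨a', b1', b2', b3', b4'⟩ h' e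
    simp only [coe_filter, mem_univ, true_and, Set.mem_ofPred_eq, Prod.mk.injEq] at h h' e ⊢
    have := hrow _ _ _ h.1; have := hrow _ _ _ h.2
    have := hrow _ _ _ h'.1; have := hrow _ _ _ h'.2
    grind

/-- A pairing of the four corners of a rectangle forces equal rows, equal columns, or equal colours
along a diagonal; in each case three of the four coordinates determine the last, as the colouring is
proper. -/
lemma randomMean_cycleSum_le (h₀ : 0 ≤ μ) (h₁ : μ ≤ 1) {c : A × B → α} (hΓ : ∀ p, c p ∈ Γ)
    (hrow : ∀ a b b', c (a, b) = c (a, b') → b = b')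
    (hcol : ∀ a a' b, c (a, b) = c (a', b) → a = a') {n : ℕ} (hA : Fintype.card A = n)
    (hB : Fintype.card B = n) :
    randomMean Γ μ (fun U => cycleSum fun a b => centred μ U (c (a, b))) ≤ 3 * (n : ℝ) ^ 3 := by
  classical
  have hcard : Fintype.card (A × B × B) = n ^ 3 := by
    simp only [Fintype.card_prod, hA, hB]; ring
  have hcard' : Fintype.card (A × A × B) = n ^ 3 := by
    simp only [Fintype.card_prod, hA, hB]; ring
  have h := randomMean_sum_four_le (Γ := Γ) h₀ h₁ (ι := A × A × B × B)
    (fun q => c (q.1, q.2.2.1)) (fun q => c (q.2.1, q.2.2.1)) (fun q => c (q.1, q.2.2.2))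
    (fun q => c (q.2.1, q.2.2.2)) (fun _ => hΓ _) (fun _ => hΓ _) (fun _ => hΓ _) (fun _ => hΓ _)
    (k := n ^ 3) ?_ ?_ ?_
  · simp only [cycleSum]
    exact_mod_cast h
  · rw [← hcard, ← card_univ]
    refine card_le_card_of_injOn (fun q => (q.1, q.2.2))
      (fun _ _ => mem_coe.2 (mem_univ _)) ?_
    rintro ⟨a, a2, b, b2⟩ h ⟨a', a2', b', b2'⟩ h' e
    simp only [coe_filter, mem_univ, true_and, Set.mem_ofPred_eq, Prod.mk.injEq] at h h' e ⊢
    have := hcol _ _ _ h.1; have := hcol _ _ _ h'.1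
    grind
  · rw [← hcard', ← card_univ]
    refine card_le_card_of_injOn (fun q => (q.1, q.2.1, q.2.2.1))
      (fun _ _ => mem_coe.2 (mem_univ _)) ?_
    rintro ⟨a, a2, b, b2⟩ h ⟨a', a2', b', b2'⟩ h' e
    simp only [coe_filter, mem_univ, true_and, Set.mem_ofPred_eq, Prod.mk.injEq] at h h' e ⊢
    have := hrow _ _ _ h.1; have := hrow _ _ _ h'.1
    grind
  · rw [← hcard', ← card_univ]
    refine card_le_card_of_injOn (fun q => (q.1, q.2.1, q.2.2.1))
      (fun _ _ => mem_coe.2 (mem_univ _)) ?_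
    rintro ⟨a, a2, b, b2⟩ h ⟨a', a2', b', b2'⟩ h' e
    simp only [coe_filter, mem_univ, true_and, Set.mem_ofPred_eq, Prod.mk.injEq] at h h' e ⊢
    obtain ⟨rfl, rfl, rfl⟩ := e
    exact ⟨rfl, rfl, rfl, hrow _ _ _ (h.1.symm.trans h'.1)⟩

variable [DecidableEq A] [DecidableEq B]

/-- A set of colours that behaves like a random set of density `μ`. -/
structure IsReserve (c : A × B → α) (μ : ℝ) (n : ℕ) (U : Finset α) : Prop where
  row : ∀ a, ((#{b | c (a, b) ∈ U} : ℝ) - μ * n) ^ 4 ≤ 18 * (n : ℝ) ^ 3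
  col : ∀ b, ((#{a | c (a, b) ∈ U} : ℝ) - μ * n) ^ 4 ≤ 18 * (n : ℝ) ^ 3
  rect : ∀ X Y, ((#{p ∈ X ×ˢ Y | c p ∈ U} : ℝ) - μ * #X * #Y) ^ 4 ≤ 18 * (n : ℝ) ^ 7

theorem exists_isReserve (h₀ : 0 < μ) (h₁ : μ < 1) {c : A × B → α} (hΓ : ∀ p, c p ∈ Γ)
    (hrow : ∀ a b b', c (a, b) = c (a, b') → b = b')
    (hcol : ∀ a a' b, c (a, b) = c (a', b) → a = a') {n : ℕ} (hn : 0 < n)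
    (hA : Fintype.card A = n) (hB : Fintype.card B = n) :
    ∃ U ⊆ Γ, (#U : ℝ) ≤ 2 * μ * #Γ ∧ IsReserve c μ n U := by
  have hn' : (0 : ℝ) < n := Nat.cast_pos.2 hn
  have hΓpos : (0 : ℝ) < #Γ := by
    have : Nonempty A := Fintype.card_pos_iff.1 (hA ▸ hn)
    have : Nonempty B := Fintype.card_pos_iff.1 (hB ▸ hn)
    exact Nat.cast_pos.2 (card_pos.2 ⟨c (Classical.arbitrary _), hΓ _⟩)
  set Q₁ : Finset α → ℝ := fun U => ∑ a, (∑ b, centred μ U (c (a, b))) ^ 4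
  set Q₂ : Finset α → ℝ := fun U => ∑ b, (∑ a, centred μ U (c (a, b))) ^ 4
  set Q₃ : Finset α → ℝ := fun U => cycleSum fun a b => centred μ U (c (a, b))
  have e1 : randomMean Γ μ Q₁ ≤ 3 * (n : ℝ) ^ 3 :=
    randomMean_row_moment_le h₀.le h₁.le hΓ hrow hA hB
  have e2 : randomMean Γ μ Q₂ ≤ 3 * (n : ℝ) ^ 3 :=
    randomMean_row_moment_le (c := fun p : B × A => c p.swap) h₀.le h₁.le (fun _ => hΓ _)
      (fun b a a' h => hcol a a' b h) hB hA
  have e3 : randomMean Γ μ Q₃ ≤ 3 * (n : ℝ) ^ 3 :=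
    randomMean_cycleSum_le h₀.le h₁.le hΓ hrow hcol hA hB
  -- The weights give both summands mean at most 9n³μ|Γ|. As both are nonnegative, one U keeps each
  -- at most twice this value, which bounds the moments and |U| together.
  obtain ⟨U, hU, h⟩ := exists_le_of_randomMean_le (Γ := Γ) h₀ h₁
    (F := fun U => (Q₁ U + Q₂ U + Q₃ U) * (μ * #Γ) + #U * (9 * (n : ℝ) ^ 3))
    (C := 18 * (n : ℝ) ^ 3 * (μ * #Γ)) (by
      rw [randomMean_add, randomMean_mul_const, randomMean_mul_const, randomMean_add, randomMean_add,
        randomMean_card]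
      have : 0 < μ * #Γ := by positivity
      nlinarith)
  have q1 : 0 ≤ Q₁ U := sum_nonneg fun _ _ => Even.pow_nonneg (by decide) _
  have q2 : 0 ≤ Q₂ U := sum_nonneg fun _ _ => Even.pow_nonneg (by decide) _
  have q3 : 0 ≤ Q₃ U := cycleSum_nonneg _
  have hm : 0 < μ * #Γ := by positivity
  have hsum : Q₁ U + Q₂ U + Q₃ U ≤ 18 * (n : ℝ) ^ 3 := by
    refine le_of_mul_le_mul_right ?_ hm
    have : (0 : ℝ) ≤ #U * (9 * (n : ℝ) ^ 3) := by positivity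
    linarith
  refine ⟨U, hU, ?_, ?_, ?_, ?_⟩
  · have h3 : 0 < 9 * (n : ℝ) ^ 3 := by positivity
    refine le_of_mul_le_mul_right ?_ h3
    have : 0 ≤ (Q₁ U + Q₂ U + Q₃ U) * (μ * #Γ) := by positivity
    linarith
  · intro a
    have h1 : (#{b | c (a, b) ∈ U} : ℝ) - μ * n = ∑ b, centred μ U (c (a, b)) := by
      simp only [centred, sum_sub_distrib, sum_boole, sum_const, card_univ, hB, nsmul_eq_mul]
      ring
    rw [h1]
    refine le_trans ?_ ((by linarith : Q₁ U ≤ Q₁ U + Q₂ U + Q₃ U).trans hsum)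
    exact single_le_sum (f := fun a => (∑ b, centred μ U (c (a, b))) ^ 4)
      (fun _ _ => Even.pow_nonneg (by decide) _) (mem_univ a)
  · intro b
    have h1 : (#{a | c (a, b) ∈ U} : ℝ) - μ * n = ∑ a, centred μ U (c (a, b)) := by
      simp only [centred, sum_sub_distrib, sum_boole, sum_const, card_univ, hA, nsmul_eq_mul]
      ring
    rw [h1]
    refine le_trans ?_ ((by linarith : Q₂ U ≤ Q₁ U + Q₂ U + Q₃ U).trans hsum)
    exact single_le_sum (f := fun b => (∑ a, centred μ U (c (a, b))) ^ 4)
      (fun _ _ => Even.pow_nonneg (by decide) _) (mem_univ b)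
  · intro X Y
    have h1 : (#{p ∈ X ×ˢ Y | c p ∈ U} : ℝ) - μ * #X * #Y =
        ∑ x ∈ X, ∑ y ∈ Y, centred μ U (c (x, y)) := by
      rw [← sum_product']
      simp only [centred, sum_sub_distrib, sum_boole, sum_const, card_product, nsmul_eq_mul,
        Nat.cast_mul]
      ring
    rw [h1]
    refine (sum_product_pow_four_le _ X Y).trans ?_
    have hX : (#X : ℝ) ≤ n := by exact_mod_cast hA ▸ card_le_univ X
    have hY : (#Y : ℝ) ≤ n := by exact_mod_cast hB ▸ card_le_univ Y
    calc (#X : ℝ) ^ 2 * (#Y : ℝ) ^ 2 * Q₃ U ≤ (n : ℝ) ^ 2 * (n : ℝ) ^ 2 * (18 * (n : ℝ) ^ 3) := by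
          gcongr
          linarith
      _ = _ := by ring

end Moments

/-! ### Rare colours and the linked matching M₀. -/

section Rare

variable {A B α : Type*} [Fintype A] [Fintype B] [DecidableEq A] [DecidableEq B] [DecidableEq α]

lemma card_fst_section (P : A × B → Prop) [DecidablePred P] :
    #{p | P p} = ∑ a, #{b | P (a, b)} := by
  simp only [card_filter, Fintype.sum_prod_type]

lemma card_filter_color_mem (c : A × B → α) (R : Finset α) :
    #{p | c p ∈ R} = ∑ γ ∈ R, #{p | c p = γ} := by
  rw [card_eq_sum_card_fiberwise (f := c) (t := R) (fun p hp => by simpa using hp)]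
  refine sum_congr rfl fun γ hγ => ?_
  congr 1
  ext p
  simp only [mem_filter, mem_univ, true_and, and_iff_right_iff_imp]
  exact fun h => h ▸ hγ

/-- If the colours of `R` have at most `K` cells each, few rows contain more than `w` of their
cells. -/
lemma card_heavy_rows_mul_le {c : A × B → α} {R : Finset α} {K : ℕ}
    (hR : ∀ γ ∈ R, #{p | c p = γ} ≤ K) (w : ℕ) :
    #{a | w < #{b | c (a, b) ∈ R}} * w ≤ #R * K := by
  have h1 : #{p | c p ∈ R} ≤ #R * K := by
    rw [card_filter_color_mem]
    exact sum_le_card_nsmul _ _ _ hR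
  refine le_trans ?_ h1
  rw [card_fst_section]
  refine le_trans ?_ (sum_le_sum_of_subset (subset_univ {a | w < #{b | c (a, b) ∈ R}}))
  exact card_nsmul_le_sum _ _ _ fun a ha => (mem_filter.1 ha).2.le

/-- Representatives of the colours outside `U` that have at most `K` cells. -/
lemma exists_rare_cells (c : A × B → α) (U : Finset α) (K : ℕ) :
    ∃ H : Finset (A × B), Set.InjOn c H ∧ (∀ h ∈ H, c h ∉ U) ∧
      (∀ h ∈ H, #{p | c p = c h} ≤ K) ∧
      #(univ.image c) * K ≤ #H * K + #U * K + Fintype.card A * Fintype.card B := by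
  set Γ := univ.image c with hΓ
  set G := Γ.filter fun γ => γ ∉ U ∧ #{p | c p = γ} ≤ K with hG
  obtain ⟨H, -, hinj, himg⟩ := exists_subset_injOn_image_eq_of_surjOn (f := c) Set.univ G (by
    intro γ hγ
    obtain ⟨p, hp, rfl⟩ := mem_image.1 (mem_filter.1 hγ).1
    exact ⟨p, Set.mem_univ _, rfl⟩)
  have hmem : ∀ h ∈ H, c h ∈ G := fun h hh => himg ▸ mem_image_of_mem c hh
  refine ⟨H, hinj, fun h hh => (mem_filter.1 (hmem h hh)).2.1,
    fun h hh => (mem_filter.1 (hmem h hh)).2.2, ?_⟩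
  · have hcard : #H = #G := by rw [← himg, card_image_of_injOn hinj]
    set J := Γ.filter fun γ => K < #{p | c p = γ} with hJ
    have hJK : #J * K ≤ Fintype.card A * Fintype.card B := by
      rw [← Fintype.card_prod, ← card_univ,
        card_eq_sum_card_image c univ]
      refine le_trans ?_ (sum_le_sum_of_subset (filter_subset _ _ : J ⊆ Γ))
      exact card_nsmul_le_sum _ _ _ fun γ hγ => (mem_filter.1 hγ).2.le
    have hsub : Γ ⊆ G ∪ U ∪ J := by
      intro γ hγ
      simp only [hG, hJ, mem_union, mem_filter, hγ, true_and]
      by_cases h1 : γ ∈ U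
      · exact Or.inl (Or.inr h1)
      · by_cases h2 : #{p | c p = γ} ≤ K
        · exact Or.inl (Or.inl ⟨h1, h2⟩)
        · exact Or.inr (not_le.1 h2)
    have h1 : #Γ ≤ #G + #U + #J :=
      (card_le_card hsub).trans ((card_union_le _ _).trans
        (Nat.add_le_add_right (card_union_le _ _) _))
    rw [hcard]
    calc #Γ * K ≤ (#G + #U + #J) * K := Nat.mul_le_mul_right _ h1
      _ = #G * K + #U * K + #J * K := by ring
      _ ≤ _ := by omega

/-- A system of distinct representatives of large sets. -/
lemma exists_injOn_of_card_le {V W : Type*} [DecidableEq W] [Nonempty W]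
    (X : Finset V) (F : V → Finset W)
    (h : ∀ x ∈ X, #X ≤ #(F x)) : ∃ f : V → W, Set.InjOn f X ∧ ∀ x ∈ X, f x ∈ F x := by
  classical
  obtain ⟨f, hf, hfF⟩ := (Finset.all_card_le_biUnion_card_iff_exists_injective
    (fun x : X => F x)).1 (by
      intro s
      rcases s.eq_empty_or_nonempty with rfl | ⟨x, hx⟩
      · simp
      · refine le_trans ?_ ((h x x.2).trans (card_le_card (subset_biUnion_of_mem
          (fun x : X => F x) hx)))
        simpa using card_le_univ s)
  refine ⟨fun v => if hv : v ∈ X then f ⟨v, hv⟩ else Classical.arbitrary W, ?_, ?_⟩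
  · intro x hx y hy hxy
    simp only [mem_coe] at hx hy
    simp only [dif_pos hx, dif_pos hy] at hxy
    exact congrArg Subtype.val (hf hxy)
  · intro x hx
    simp only [dif_pos hx]
    exact hfF ⟨x, hx⟩

/-- Double counting. Rows, then columns, with fewer than 2t cells lose at most 2tn cells each, so t
good columns remain out of 5tn cells. The at least 2t² cells in Y cannot be held by fewer than t
rows with at least q cells in Y, since the other rows contribute at most nq ≤ t². -/
lemma exists_dense_pair (H : Finset (A × B)) {n t q : ℕ} (hn : 0 < n) (hA : Fintype.card A = n)
    (hB : Fintype.card B = n) (hH : 5 * t * n ≤ #H) (hq : n * q ≤ t * t) :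
    ∃ X : Finset A, ∃ Y : Finset B, #X = t ∧ #Y = t ∧ (∀ x ∈ X, 2 * t ≤ #{b | (x, b) ∈ H}) ∧
      (∀ y ∈ Y, 2 * t ≤ #{a | (a, y) ∈ H}) ∧ ∀ x ∈ X, q ≤ #{y ∈ Y | (x, y) ∈ H} := by
  set A₁ : Finset A := {a | 2 * t ≤ #{b | (a, b) ∈ H}} with hA₁
  set B₁ : Finset B := {b | 2 * t ≤ #{a ∈ A₁ | (a, b) ∈ H}} with hB₁
  have hHsum : #H ≤ ∑ b, #{a ∈ A₁ | (a, b) ∈ H} + n * (2 * t) := by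
    have e1 : #H = #{p | p ∈ H} := by simp
    rw [e1, card_fst_section, ← sum_add_sum_compl A₁]
    refine add_le_add ?_ ?_
    · simp only [card_filter]
      rw [sum_comm]
    · refine (sum_le_card_nsmul _ _ (2 * t) fun a ha => ?_).trans ?_
      · simp only [hA₁, mem_compl, mem_filter, mem_univ, true_and, not_le] at ha
        exact ha.le
      · exact Nat.mul_le_mul_right _ (hA ▸ card_le_univ _)
  have hB₁card : t ≤ #B₁ := by
    have h1 : ∑ b, #{a ∈ A₁ | (a, b) ∈ H} ≤ #B₁ * n + n * (2 * t) := by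
      rw [← sum_add_sum_compl B₁]
      refine add_le_add ?_ ?_
      · exact sum_le_card_nsmul _ _ n fun b _ => hA ▸ card_le_univ _
      · refine (sum_le_card_nsmul _ _ (2 * t) fun b hb => ?_).trans ?_
        · simp only [hB₁, mem_compl, mem_filter, mem_univ, true_and, not_le] at hb
          exact hb.le
        · exact Nat.mul_le_mul_right _ (hB ▸ card_le_univ _)
    refine Nat.le_of_mul_le_mul_right ?_ hn
    nlinarith
  obtain ⟨Y, hYB, hYcard⟩ := exists_subset_card_eq hB₁card
  set X₁ : Finset A := {a ∈ A₁ | q ≤ #{y ∈ Y | (a, y) ∈ H}} with hX₁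
  have hX₁card : t ≤ #X₁ := by
    rcases t.eq_zero_or_pos with rfl | ht
    · exact Nat.zero_le _
    have h1 : t * (2 * t) ≤ ∑ y ∈ Y, #{a ∈ A₁ | (a, y) ∈ H} := by
      rw [← hYcard]
      exact card_nsmul_le_sum _ _ _ fun y hy => hYcard ▸ (mem_filter.1 (hYB hy)).2
    have h2 : ∑ y ∈ Y, #{a ∈ A₁ | (a, y) ∈ H} = ∑ a ∈ A₁, #{y ∈ Y | (a, y) ∈ H} := by
      simp only [card_filter]
      exact sum_comm
    have h3 : ∑ a ∈ A₁, #{y ∈ Y | (a, y) ∈ H} ≤ #X₁ * t + n * q := by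
      rw [← sum_sdiff (filter_subset _ _ : X₁ ⊆ A₁), add_comm]
      refine add_le_add ?_ ?_
      · exact sum_le_card_nsmul _ _ t fun a _ => hYcard ▸ card_filter_le _ _
      · refine (sum_le_card_nsmul _ _ q fun a ha => ?_).trans ?_
        · simp only [mem_sdiff, mem_filter, not_and, not_le] at ha
          exact (ha.2 ha.1).le
        · exact Nat.mul_le_mul_right _ (hA ▸ card_le_univ _)
    refine Nat.le_of_mul_le_mul_right ?_ ht
    nlinarith
  obtain ⟨X, hXX, hXcard⟩ := exists_subset_card_eq hX₁card
  refine ⟨X, Y, hXcard, hYcard, ?_, ?_, ?_⟩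
  · exact fun x hx => (mem_filter.1 (mem_filter.1 (hXX hx)).1).2
  · intro y hy
    refine (mem_filter.1 (hYB hy)).2.trans (card_le_card fun a ha => ?_)
    simp only [mem_filter, mem_univ, true_and] at ha ⊢
    exact ha.2
  · exact fun x hx => (mem_filter.1 (hXX hx)).2

/-- A matching that covers `X` and `Y`, within a set `H` of cells of different colours such that
each row in `X` has many cells of `H` in columns of `Y`. -/
lemma exists_linked_matching {c : A × B → α} {H : Finset (A × B)} (hc : Set.InjOn c H) {n t q : ℕ}
    (hn : 0 < n) (hA : Fintype.card A = n) (hB : Fintype.card B = n) (hH : 5 * t * n ≤ #H)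
    (hq : n * q ≤ t * t) :
    ∃ X : Finset A, ∃ Y : Finset B, ∃ M₀ ⊆ H, IsRainbow c M₀ ∧ #X = t ∧
      X ⊆ M₀.image Prod.fst ∧ Y ⊆ M₀.image Prod.snd ∧ ∀ x ∈ X, q ≤ #{y ∈ Y | (x, y) ∈ H} := by
  obtain ⟨X, Y, hX, hY, hXH, hYH, hXY⟩ := exists_dense_pair H hn hA hB hH hq
  have : Nonempty A := Fintype.card_pos_iff.1 (hA ▸ hn)
  have : Nonempty B := Fintype.card_pos_iff.1 (hB ▸ hn)
  -- Rows of X are matched outside Y and columns of Y outside X, so the two families cannot collide;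
  -- t of the 2t choices survive, enough for distinct representatives.
  obtain ⟨f, hf, hfH⟩ := exists_injOn_of_card_le X (fun x => ({b | (x, b) ∈ H} : Finset B) \ Y) (by
    intro x hx
    have := le_card_sdiff Y ({b | (x, b) ∈ H} : Finset B)
    have := hXH x hx
    omega)
  obtain ⟨g, hg, hgH⟩ := exists_injOn_of_card_le Y (fun y => ({a | (a, y) ∈ H} : Finset A) \ X) (by
    intro y hy
    have := le_card_sdiff X ({a | (a, y) ∈ H} : Finset A)
    have := hYH y hy
    omega)
  simp only [mem_sdiff, mem_filter, mem_univ, true_and] at hfH hgH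
  set M₀ : Finset (A × B) := X.image (fun x => (x, f x)) ∪ Y.image (fun y => (g y, y)) with hM₀
  have hM₀H : M₀ ⊆ H := by
    intro p hp
    simp only [hM₀, mem_union, mem_image] at hp
    rcases hp with ⟨x, hx, rfl⟩ | ⟨y, hy, rfl⟩
    · exact (hfH x hx).1
    · exact (hgH y hy).1
  refine ⟨X, Y, M₀, hM₀H, ?_, hX, ?_, ?_, hXY⟩
  · intro p hp p' hp' h
    rcases h with h | h | h
    · simp only [hM₀, mem_union, mem_image] at hp hp'
      rcases hp with ⟨x, hx, rfl⟩ | ⟨y, hy, rfl⟩ <;> rcases hp' with ⟨x', hx', rfl⟩ | ⟨y', hy', rfl⟩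
      · simp only at h; rw [h]
      · simp only at h; exact absurd (h ▸ hx) (hgH y' hy').2
      · simp only at h; exact absurd (h ▸ hx') (hgH y hy).2
      · rw [hg hy hy' h]
    · simp only [hM₀, mem_union, mem_image] at hp hp'
      rcases hp with ⟨x, hx, rfl⟩ | ⟨y, hy, rfl⟩ <;> rcases hp' with ⟨x', hx', rfl⟩ | ⟨y', hy', rfl⟩
      · rw [hf hx hx' h]
      · simp only at h; exact absurd (h ▸ hy') (hfH x hx).2
      · simp only at h; exact absurd (h ▸ hy) (hfH x' hx').2
      · simp only at h; rw [h]
    · exact hc (hM₀H hp) (hM₀H hp') h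
  · exact fun x hx => mem_image.2 ⟨(x, f x), mem_union_left _ (mem_image_of_mem _ hx), rfl⟩
  · exact fun y hy => mem_image.2 ⟨(g y, y), mem_union_right _ (mem_image_of_mem _ hy), rfl⟩

end Rare

/-! ### Augmenting one part of a matching while the rest stays fixed. -/

section Phases

variable {A B α : Type*} [DecidableEq A] [DecidableEq B] [DecidableEq α]

lemma image_fst_image_swap (N : Finset (A × B)) :
    (N.image Prod.swap).image Prod.fst = N.image Prod.snd := by
  rw [image_image]; rfl

lemma image_snd_image_swap (N : Finset (A × B)) :
    (N.image Prod.swap).image Prod.snd = N.image Prod.fst := by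
  rw [image_image]; rfl

lemma IsRainbow.of_image_swap {c : A × B → α} {M : Finset (B × A)}
    (h : IsRainbow (fun p : B × A => c p.swap) M) : IsRainbow c (M.image Prod.swap) := by
  have := h.image_swap
  simpa only [Prod.swap_swap] using this

/-- What is new in N' is compatible with P: rows come from D, the column is y, and the only new
colour avoids Z, which contains the colours of P. -/
lemma IsAugmentation.union {c : A × B → α} {N P N' : Finset (A × B)} {D : Finset A} {Z : Finset α}
    {y : B} (h : IsAugmentation c N D Z y N') (hNP : IsRainbow c (N ∪ P)) (hdisj : Disjoint N P)
    (hD : Disjoint D (P.image Prod.fst)) (hy : y ∉ P.image Prod.snd) (hZ : P.image c ⊆ Z) :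
    IsRainbow c (N' ∪ P) ∧ #(N' ∪ P) = #N + 1 + #P := by
  have key : ∀ p ∈ N, ∀ q ∈ P, ¬ (p.1 = q.1 ∨ p.2 = q.2 ∨ c p = c q) := fun p hp q hq hpq =>
    disjoint_left.1 hdisj hp (hNP p (mem_union_left _ hp) q (mem_union_right _ hq) hpq ▸ hq)
  have h1 : Disjoint (N'.image Prod.fst) (P.image Prod.fst) := by
    refine disjoint_left.2 fun a ha haP => ?_
    rcases mem_union.1 (h.rows ha) with ha | ha
    · obtain ⟨p, hp, rfl⟩ := mem_image.1 ha
      obtain ⟨q, hq, e⟩ := mem_image.1 haP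
      exact key p hp q hq (Or.inl e.symm)
    · exact disjoint_left.1 hD ha haP
  have h2 : Disjoint (N'.image Prod.snd) (P.image Prod.snd) := by
    rw [h.cols]
    refine disjoint_left.2 fun b hb hbP => ?_
    rcases mem_insert.1 hb with rfl | hb
    · exact hy hbP
    · obtain ⟨p, hp, rfl⟩ := mem_image.1 hb
      obtain ⟨q, hq, e⟩ := mem_image.1 hbP
      exact key p hp q hq (Or.inr (Or.inl e.symm))
  have h3 : Disjoint (N'.image c) (P.image c) := by
    obtain ⟨u, hu, hsub⟩ := h.colors
    refine disjoint_left.2 fun γ hγ hγP => ?_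
    rcases mem_insert.1 (hsub hγ) with rfl | hγ
    · exact hu (hZ hγP)
    · obtain ⟨p, hp, rfl⟩ := mem_image.1 hγ
      obtain ⟨q, hq, e⟩ := mem_image.1 hγP
      exact key p hp q hq (Or.inr (Or.inr e.symm))
  refine ⟨h.rainbow.union (hNP.mono subset_union_right) h1 h2 h3, ?_⟩
  rw [card_union_of_disjoint, h.card_eq]
  exact disjoint_left.2 fun p hp hpP =>
    disjoint_left.1 h1 (mem_image_of_mem _ hp) (mem_image_of_mem _ hpP)

/-- The mirror image of `IsAugmentation`. -/
structure IsColAugmentation (c : A × B → α) (N : Finset (A × B)) (D : Finset B) (Z : Finset α)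
    (x : A) (N' : Finset (A × B)) : Prop where
  rainbow : IsRainbow c N'
  card_eq : #N' = #N + 1
  cols : N'.image Prod.snd ⊆ N.image Prod.snd ∪ D
  rows : N'.image Prod.fst = insert x (N.image Prod.fst)
  colors : ∃ u ∉ Z, N'.image c ⊆ insert u (N.image c)

lemma IsAugmentation.image_swap {c : A × B → α} {N : Finset (A × B)} {D : Finset B} {Z : Finset α}
    {x : A} {N' : Finset (B × A)}
    (h : IsAugmentation (fun p : B × A => c p.swap) (N.image Prod.swap) D Z x N') :
    IsColAugmentation c N D Z x (N'.image Prod.swap) where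
  rainbow := h.rainbow.of_image_swap
  card_eq := by
    rw [card_image_of_injective _ Prod.swap_injective, h.card_eq,
      card_image_of_injective _ Prod.swap_injective]
  cols := by simpa only [image_fst_image_swap, image_snd_image_swap] using h.rows
  rows := by simpa only [image_fst_image_swap, image_snd_image_swap] using h.cols
  colors := by
    obtain ⟨u, hu, h⟩ := h.colors
    refine ⟨u, hu, ?_⟩
    simpa only [image_image, Function.comp_def, Prod.swap_swap] using h

lemma IsColAugmentation.union {c : A × B → α} {N P N' : Finset (A × B)} {D : Finset B}
    {Z : Finset α} {x : A} (h : IsColAugmentation c N D Z x N') (hNP : IsRainbow c (N ∪ P))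
    (hdisj : Disjoint N P) (hD : Disjoint D (P.image Prod.snd)) (hx : x ∉ P.image Prod.fst)
    (hZ : P.image c ⊆ Z) : IsRainbow c (N' ∪ P) ∧ #(N' ∪ P) = #N + 1 + #P := by
  have key : ∀ p ∈ N, ∀ q ∈ P, ¬ (p.1 = q.1 ∨ p.2 = q.2 ∨ c p = c q) := fun p hp q hq hpq =>
    disjoint_left.1 hdisj hp (hNP p (mem_union_left _ hp) q (mem_union_right _ hq) hpq ▸ hq)
  have h1 : Disjoint (N'.image Prod.snd) (P.image Prod.snd) := by
    refine disjoint_left.2 fun a ha haP => ?_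
    rcases mem_union.1 (h.cols ha) with ha | ha
    · obtain ⟨p, hp, rfl⟩ := mem_image.1 ha
      obtain ⟨q, hq, e⟩ := mem_image.1 haP
      exact key p hp q hq (Or.inr (Or.inl e.symm))
    · exact disjoint_left.1 hD ha haP
  have h2 : Disjoint (N'.image Prod.fst) (P.image Prod.fst) := by
    rw [h.rows]
    refine disjoint_left.2 fun b hb hbP => ?_
    rcases mem_insert.1 hb with rfl | hb
    · exact hx hbP
    · obtain ⟨p, hp, rfl⟩ := mem_image.1 hb
      obtain ⟨q, hq, e⟩ := mem_image.1 hbP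
      exact key p hp q hq (Or.inl e.symm)
  have h3 : Disjoint (N'.image c) (P.image c) := by
    obtain ⟨u, hu, hsub⟩ := h.colors
    refine disjoint_left.2 fun γ hγ hγP => ?_
    rcases mem_insert.1 (hsub hγ) with rfl | hγ
    · exact hu (hZ hγP)
    · obtain ⟨p, hp, rfl⟩ := mem_image.1 hγ
      obtain ⟨q, hq, e⟩ := mem_image.1 hγP
      exact key p hp q hq (Or.inr (Or.inr e.symm))
  refine ⟨h.rainbow.union (hNP.mono subset_union_right) h2 h1 h3, ?_⟩
  rw [card_union_of_disjoint, h.card_eq]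
  exact disjoint_left.2 fun p hp hpP =>
    disjoint_left.1 h1 (mem_image_of_mem _ hp) (mem_image_of_mem _ hpP)

variable [Fintype A] [Fintype B]

/-- Colours of R fill at most 2nK cells, so at most 2nK/w rows hold more than w of them. After these
rows are dropped from E, more than n/w rows remain, each with at most 3w cells coloured from U ∪ R,
and switching applies with t = 3w, g = w. -/
lemma exists_augmentations_of_rare {c : A × B → α}
    (hrow : ∀ a b b', c (a, b) = c (a, b') → b = b') {n K w : ℕ} (hA : Fintype.card A = n)
    (hB : Fintype.card B = n) {U R : Finset α} (hU : ∀ a, #{b | c (a, b) ∈ U} ≤ 2 * w)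
    (hR : ∀ γ ∈ R, #{p | c p = γ} ≤ K) (hRcard : #R ≤ 2 * n) {N : Finset (A × B)}
    (hN : IsRainbow c N) {E : Finset A} (hE : Disjoint E (N.image Prod.fst))
    (hEcard : n * (2 * K + 1) < #E * w) :
    ∃ S : Finset B, n ≤ #S + #N + 4 * w ∧ ∀ y ∈ S, y ∉ N.image Prod.snd ∧
      ∃ N', IsAugmentation c N E (U ∪ R) y N' := by
  set D : Finset A := {a ∈ E | #{b | c (a, b) ∈ R} ≤ w} with hD
  have hDE : D ⊆ E := filter_subset _ _
  have hbad : #(E \ D) * w ≤ 2 * n * K := by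
    refine le_trans (Nat.mul_le_mul_right _ (card_le_card ?_))
      ((card_heavy_rows_mul_le hR w).trans (Nat.mul_le_mul_right _ hRcard))
    intro a ha
    simp only [hD, mem_sdiff, mem_filter, not_and, not_le, mem_univ, true_and] at ha ⊢
    exact ha.2 ha.1
  have hNn : #N ≤ n := by
    rw [← hN.card_image_fst, ← hA]
    exact card_le_univ _
  have hDcard : #N < #D * w := by
    have h1 : #E * w = #(E \ D) * w + #D * w := by
      rw [← add_mul, card_sdiff_add_card_eq_card hDE]
    have h2 : n * (2 * K + 1) = 2 * n * K + n := by ring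
    omega
  obtain ⟨S, hS, hSaug⟩ := exists_augmentations hrow hN (hE.mono_left hDE) (Z := U ∪ R)
    (t := 3 * w) (g := w) (by
      intro a ha
      have h1 : ({b | c (a, b) ∈ U ∪ R} : Finset B) =
          ({b | c (a, b) ∈ U} : Finset B) ∪ ({b | c (a, b) ∈ R} : Finset B) := by
        ext b; simp
      rw [h1]
      have h2 := card_union_le ({b | c (a, b) ∈ U} : Finset B) ({b | c (a, b) ∈ R} : Finset B)
      have h3 := hU a
      have h4 : #{b | c (a, b) ∈ R} ≤ w := (mem_filter.1 ha).2
      omega) hDcard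
  refine ⟨S, by omega, fun y hy => ⟨(hSaug y hy).1, ?_⟩⟩
  obtain ⟨N', h⟩ := (hSaug y hy).2
  exact ⟨N', h.rainbow, h.card_eq, h.rows.trans (union_subset_union_right hDE), h.cols, h.colors⟩

lemma exists_colAugmentations_of_rare {c : A × B → α}
    (hcol : ∀ a a' b, c (a, b) = c (a', b) → a = a') {n K w : ℕ} (hA : Fintype.card A = n)
    (hB : Fintype.card B = n) {U R : Finset α} (hU : ∀ b, #{a | c (a, b) ∈ U} ≤ 2 * w)
    (hR : ∀ γ ∈ R, #{p | c p = γ} ≤ K) (hRcard : #R ≤ 2 * n) {N : Finset (A × B)}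
    (hN : IsRainbow c N) {E : Finset B} (hE : Disjoint E (N.image Prod.snd))
    (hEcard : n * (2 * K + 1) < #E * w) :
    ∃ S : Finset A, n ≤ #S + #N + 4 * w ∧ ∀ x ∈ S, x ∉ N.image Prod.fst ∧
      ∃ N', IsColAugmentation c N E (U ∪ R) x N' := by
  have himg := image_fst_image_swap N
  have himg' := image_snd_image_swap N
  obtain ⟨S, hS, hSaug⟩ := exists_augmentations_of_rare (c := fun p : B × A => c p.swap)
    (fun b a a' h => hcol a a' b h) hB hA hU (by
      intro γ hγ
      refine le_trans (le_of_eq ?_) (hR γ hγ)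
      refine card_bij (fun p _ => p.swap) (fun p hp => by simpa using hp)
        (fun p _ q _ h => Prod.swap_injective h)
        (fun p hp => ⟨p.swap, by simpa using hp, Prod.swap_swap p⟩)) hRcard hN.image_swap
      (by rwa [himg]) hEcard
  rw [card_image_of_injective _ Prod.swap_injective] at hS
  refine ⟨S, hS, fun x hx => ⟨himg' ▸ (hSaug x hx).1, ?_⟩⟩
  obtain ⟨N', h⟩ := (hSaug x hx).2
  exact ⟨_, h.image_swap⟩

/-- A rainbow matching `M₀` inside a set `H` of cells of rare and distinct colours outside `U`,
where `M₀` covers `X` and `Y`, and each row in `X` has many cells of `H` in columns of `Y`. -/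
structure IsLinkedSystem (c : A × B → α) (n K w : ℕ) (U : Finset α) (H M₀ : Finset (A × B))
    (X : Finset A) (Y : Finset B) : Prop where
  cardA : Fintype.card A = n
  cardB : Fintype.card B = n
  hrow : ∀ a b b', c (a, b) = c (a, b') → b = b'
  hcol : ∀ a a' b, c (a, b) = c (a', b) → a = a'
  rowU : ∀ a, #{b | c (a, b) ∈ U} ≤ 2 * w
  colU : ∀ b, #{a | c (a, b) ∈ U} ≤ 2 * w
  w_pos : 0 < w
  injOn : Set.InjOn c H
  notMem : ∀ h ∈ H, c h ∉ U
  rare : ∀ h ∈ H, #{p | c p = c h} ≤ K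
  subset : M₀ ⊆ H
  rainbow : IsRainbow c M₀
  rows : X ⊆ M₀.image Prod.fst
  cols : Y ⊆ M₀.image Prod.snd
  linked : ∀ x ∈ X, 20 * w ≤ #{y ∈ Y | (x, y) ∈ H}
  size : n + 14 * w * w < #X * w

variable {c : A × B → α} {n K w : ℕ} {U : Finset α} {H M₀ : Finset (A × B)} {X : Finset A}
  {Y : Finset B}

lemma IsRainbow.card_le {M : Finset (A × B)} (hM : IsRainbow c M) (hA : Fintype.card A = n) :
    #M ≤ n := by
  rw [← hM.card_image_fst, ← hA]
  exact card_le_univ _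

lemma notMem_of_colors_subset {N N' P : Finset (A × B)} {Z : Finset α}
    (h : ∃ u ∉ Z, N'.image c ⊆ insert u (N.image c)) (hU : U ⊆ Z)
    (hN : ∀ p ∈ N, c p ∉ U) (hP : ∀ p ∈ P, c p ∉ U) : ∀ p ∈ N' ∪ P, c p ∉ U := by
  obtain ⟨u, hu, h⟩ := h
  intro p hp
  rcases mem_union.1 hp with hp | hp
  · rcases mem_insert.1 (h (mem_image_of_mem c hp)) with e | e
    · rw [e]; exact fun hh => hu (hU hh)
    · obtain ⟨q, hq, e⟩ := mem_image.1 e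
      exact e ▸ hN q hq
  · exact hP p hp

/-- The matching `M₀` extends to a rainbow matching that avoids `U` and misses few rows. -/
lemma IsLinkedSystem.exists_initial (h : IsLinkedSystem c n K w U H M₀ X Y)
    (hw : n * (2 * K + 1) < 5 * w * w) :
    ∃ M, M₀ ⊆ M ∧ IsRainbow c M ∧ (∀ p ∈ M, c p ∉ U) ∧ n ≤ #M + 5 * w := by
  classical
  set 𝒮 : Finset (Finset (A × B)) := {M | M₀ ⊆ M ∧ IsRainbow c M ∧ ∀ p ∈ M, c p ∉ U} with h𝒮
  obtain ⟨M, hM𝒮, hmax⟩ := exists_max_image 𝒮 card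
    ⟨M₀, by simpa [h𝒮] using ⟨h.rainbow, fun a b hp => h.notMem _ (h.subset hp)⟩⟩
  obtain ⟨hM₀, hM, hMU⟩ : M₀ ⊆ M ∧ IsRainbow c M ∧ ∀ p ∈ M, c p ∉ U := by
    simpa only [h𝒮, mem_filter, mem_univ, true_and] using hM𝒮
  refine ⟨M, hM₀, hM, hMU, ?_⟩
  by_contra hlt
  push Not at hlt
  set E : Finset A := univ \ M.image Prod.fst with hE
  have hEcard : #E = n - #M := by
    rw [hE, card_sdiff_of_subset (subset_univ _), hM.card_image_fst, card_univ, h.cardA]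
  have hED : Disjoint E (M.image Prod.fst) := sdiff_disjoint
  obtain ⟨S, hS, hSaug⟩ := exists_augmentations_of_rare h.hrow h.cardA h.cardB h.rowU
    (R := M₀.image c) (K := K) (by
      intro γ hγ
      obtain ⟨p, hp, rfl⟩ := mem_image.1 hγ
      exact h.rare p (h.subset hp))
    (by rw [h.rainbow.card_image_color]; have := h.rainbow.card_le h.cardA; omega)
    (hM.mono (sdiff_subset : M \ M₀ ⊆ M)) (E := E)
    (hED.mono_right (image_subset_image sdiff_subset))
    (hw.trans_le (Nat.mul_le_mul_right _ (by omega)))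
  have h1 := card_sdiff_of_subset hM₀
  have h2 := card_le_card hM₀
  -- With more than 5w rows missing, S has more columns than M₀ covers, so some y extends the
  -- matching and contradicts maximality.
  obtain ⟨y, hyS, hy⟩ : ∃ y ∈ S, y ∉ M₀.image Prod.snd := by
    by_contra! hcon
    have := card_le_card (show S ⊆ M₀.image Prod.snd from hcon)
    rw [h.rainbow.card_image_snd] at this
    have := h.w_pos
    omega
  obtain ⟨N', hN'⟩ := (hSaug y hyS).2
  have hMeq : (M \ M₀) ∪ M₀ = M := sdiff_union_of_subset hM₀
  obtain ⟨h3, h4⟩ := hN'.union (P := M₀) (by rwa [hMeq]) sdiff_disjoint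
    (hED.mono_right (image_subset_image hM₀)) hy subset_union_right
  have h5 := hmax (N' ∪ M₀) (by
    simp only [h𝒮, mem_filter, mem_univ, true_and]
    refine ⟨subset_union_right, h3, ?_⟩
    exact notMem_of_colors_subset hN'.colors subset_union_left
      (fun p hp => hMU p (sdiff_subset hp)) (fun p hp => hMU p (hM₀ hp)))
  omega

end Phases

/-! ### The exchange through a cell of H. -/

section Phases

variable {A B α : Type*} [DecidableEq A] [DecidableEq B] [DecidableEq α] [Fintype A] [Fintype B]
  {c : A × B → α} {n K w : ℕ} {U : Finset α} {H M₀ : Finset (A × B)} {X : Finset A} {Y : Finset B}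

/-- There is a row of `X` in which few cells of `H` have a colour of `M`, and which `P` matches to a
given large set `S` of columns. -/
lemma IsLinkedSystem.exists_good_cell (h : IsLinkedSystem c n K w U H M₀ X Y)
    {M P : Finset (A × B)} (hM : #M ≤ n) (hPM₀ : P ⊆ M₀) {S : Finset B}
    (hS : S ⊆ P.image Prod.snd) (hScard : #M₀ ≤ #S + 14 * w) :
    ∃ p ∈ P, p.1 ∈ X ∧ p.2 ∈ S ∧ #{y ∈ Y | (p.1, y) ∈ H ∧ c (p.1, y) ∈ M.image c} ≤ w := by
  set X₁ : Finset A := {x ∈ X | w < #{y ∈ Y | (x, y) ∈ H ∧ c (x, y) ∈ M.image c}} with hX₁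
  -- Cells of H have different colours, so at most |M| ≤ n of them repeat a colour of M.
  have h1 : #X₁ * w ≤ n := by
    calc #X₁ * w ≤ ∑ x ∈ X₁, #{y ∈ Y | (x, y) ∈ H ∧ c (x, y) ∈ M.image c} :=
          card_nsmul_le_sum _ _ _ fun x hx => (mem_filter.1 hx).2.le
      _ ≤ ∑ x, #{y | (x, y) ∈ H ∧ c (x, y) ∈ M.image c} :=
          (sum_le_sum fun x _ => card_le_card (filter_subset_filter _ (subset_univ _))).trans
            (sum_le_sum_of_subset (subset_univ _))
      _ = #{p | p ∈ H ∧ c p ∈ M.image c} :=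
          (card_fst_section fun p => p ∈ H ∧ c p ∈ M.image c).symm
      _ ≤ #(M.image c) := by
          refine card_le_card_of_injOn c (fun p hp => (mem_filter.1 hp).2.2) ?_
          exact fun p hp q hq e => h.injOn (mem_filter.1 hp).2.1 (mem_filter.1 hq).2.1 e
      _ ≤ n := card_image_le.trans hM
  set P₁ : Finset (A × B) := {p ∈ P | p.2 ∈ S} with hP₁
  have h2 : #S ≤ #P₁ := by
    refine (card_le_card (t := P₁.image Prod.snd) fun y hy => ?_).trans card_image_le
    obtain ⟨p, hp, rfl⟩ := mem_image.1 (hS hy)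
    exact mem_image_of_mem _ (mem_filter.2 ⟨hp, hy⟩)
  have hP₁M₀ : P₁ ⊆ M₀ := (filter_subset _ _).trans hPM₀
  by_contra hcon
  have h3 : X ⊆ X₁ ∪ (M₀ \ P₁).image Prod.fst := by
    intro x hx
    obtain ⟨p, hp, rfl⟩ := mem_image.1 (h.rows hx)
    rw [mem_union]
    by_contra hx'
    rw [not_or] at hx'
    have hpP₁ : p ∈ P₁ := by
      by_contra hn
      exact hx'.2 (mem_image_of_mem _ (mem_sdiff.2 ⟨hp, hn⟩))
    refine hcon ⟨p, (mem_filter.1 hpP₁).1, hx, (mem_filter.1 hpP₁).2, ?_⟩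
    by_contra hlt
    exact hx'.1 (mem_filter.2 ⟨hx, not_le.1 hlt⟩)
  have h4 : #X ≤ #X₁ + #(M₀ \ P₁) :=
    (card_le_card h3).trans ((card_union_le _ _).trans (Nat.add_le_add_left card_image_le _))
  rw [card_sdiff_of_subset hP₁M₀] at h4
  have h5 : #X ≤ #X₁ + 14 * w := by
    have := card_le_card hP₁M₀
    omega
  have h6 := Nat.mul_le_mul_right w h5
  have h7 := h.size
  rw [add_mul] at h6
  omega

/-- A cell of `H` in the row `x` whose colour is neither in `M` nor `u`, and whose column is
matched by `P` to a given large set `S` of rows. -/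
lemma IsLinkedSystem.exists_link (h : IsLinkedSystem c n K w U H M₀ X Y)
    {M P : Finset (A × B)} (hPM₀ : P ⊆ M₀) {S : Finset A} (hS : S ⊆ P.image Prod.fst)
    (hScard : #M₀ ≤ #S + 15 * w) {x : A} (hx : x ∈ X) (u : α)
    (hxM : #{y ∈ Y | (x, y) ∈ H ∧ c (x, y) ∈ M.image c} ≤ w) :
    ∃ p ∈ P, p.1 ∈ S ∧ p.2 ∈ Y ∧ (x, p.2) ∈ H ∧ c (x, p.2) ∉ M.image c ∧ c (x, p.2) ≠ u := by
  set P₁ : Finset (A × B) := {p ∈ P | p.1 ∈ S} with hP₁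
  have h2 : #S ≤ #P₁ := by
    refine (card_le_card (t := P₁.image Prod.fst) fun y hy => ?_).trans card_image_le
    obtain ⟨p, hp, rfl⟩ := mem_image.1 (hS hy)
    exact mem_image_of_mem _ (mem_filter.2 ⟨hp, hy⟩)
  have hP₁M₀ : P₁ ⊆ M₀ := (filter_subset _ _).trans hPM₀
  by_contra hcon
  have h3 : ({y ∈ Y | (x, y) ∈ H} : Finset B) ⊆
      ({y ∈ Y | (x, y) ∈ H ∧ c (x, y) ∈ M.image c} : Finset B) ∪
        (({y | c (x, y) = u} : Finset B) ∪ (M₀ \ P₁).image Prod.snd) := by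
    intro y hy
    obtain ⟨hyY, hyH⟩ := mem_filter.1 hy
    obtain ⟨p, hp, rfl⟩ := mem_image.1 (h.cols hyY)
    simp only [mem_union, mem_filter, mem_univ, true_and]
    by_contra hcon'
    simp only [not_or, not_and] at hcon'
    obtain ⟨k1, k2, k3⟩ := hcon'
    have hpP₁ : p ∈ P₁ := by
      by_contra hn
      exact k3 (mem_image_of_mem _ (mem_sdiff.2 ⟨hp, hn⟩))
    exact hcon ⟨p, (mem_filter.1 hpP₁).1, (mem_filter.1 hpP₁).2, hyY, hyH, k1 hyY hyH, k2⟩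
  have h4 := (card_le_card h3).trans ((card_union_le _ _).trans
    (Nat.add_le_add_left (card_union_le _ _) _))
  have h5 : #{y | c (x, y) = u} ≤ 1 := by
    refine card_le_one.2 fun b hb b' hb' => h.hrow x b b' ?_
    rw [(mem_filter.1 hb).2, (mem_filter.1 hb').2]
  have h6 : #((M₀ \ P₁).image Prod.snd) ≤ #M₀ - #P₁ :=
    card_image_le.trans (card_sdiff_of_subset hP₁M₀).le
  have h7 := h.linked x hx
  have h8 := h.w_pos
  omega

/-- Only the part N of M outside M₀ is switched. Augmenting at y and at x' costs the cells (x, y)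
and (x', y') of P; these two losses leave row x and column y' free, and the link (x, y') in H turns
the balance into a gain of one. -/
theorem IsLinkedSystem.exists_augmentation (h : IsLinkedSystem c n K w U H M₀ X Y)
    {M : Finset (A × B)} (hM : IsRainbow c M) (hMU : ∀ p ∈ M, c p ∉ U)
    (hlost : #(M₀ \ M) ≤ 10 * w) (hlarge : n * (2 * K + 1) < (n - #M) * w) :
    ∃ M', IsRainbow c M' ∧ (∀ p ∈ M', c p ∉ U) ∧ #M' = #M + 1 ∧ #(M₀ \ M') ≤ #(M₀ \ M) + 2 := by
  have hMn : #M ≤ n := hM.card_le h.cardA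
  set N := M \ M₀ with hN
  set P := M ∩ M₀ with hP
  have hNP : N ∪ P = M := sdiff_union_inter M M₀
  have hdisj : Disjoint N P := disjoint_left.2 fun p hp hp' =>
    (mem_sdiff.1 hp).2 (mem_inter.1 hp').2
  have hNM : N ⊆ M := sdiff_subset
  have hPM : P ⊆ M := inter_subset_left
  have hPM₀ : P ⊆ M₀ := inter_subset_right
  have hcardM : #N + #P = #M := by rw [← card_union_of_disjoint hdisj, hNP]
  have hcardM₀ : #(M₀ \ M) + #P = #M₀ := by
    rw [hP, inter_comm]; exact card_sdiff_add_card_inter M₀ M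
  have hM₀P : M₀ \ M = M₀ \ P := by
    ext p; simp only [hP, mem_sdiff, mem_inter]; tauto
  set E : Finset A := univ \ M.image Prod.fst with hE
  have hEcard : #E = n - #M := by
    rw [hE, card_sdiff_of_subset (subset_univ _), hM.card_image_fst, card_univ, h.cardA]
  have hED : Disjoint E (M.image Prod.fst) := sdiff_disjoint
  set E' : Finset B := univ \ M.image Prod.snd with hE'
  have hE'card : #E' = n - #M := by
    rw [hE', card_sdiff_of_subset (subset_univ _), hM.card_image_snd, card_univ, h.cardB]
  have hE'D : Disjoint E' (M.image Prod.snd) := sdiff_disjoint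
  have hM₀n := h.rainbow.card_le h.cardA
  have hrare : ∀ γ ∈ M₀.image c, #{p | c p = γ} ≤ K := by
    intro γ hγ
    obtain ⟨p, hp, rfl⟩ := mem_image.1 hγ
    exact h.rare p (h.subset hp)
  have hM₀c : #(M₀.image c) ≤ n := by rw [h.rainbow.card_image_color]; exact hM₀n
  obtain ⟨S, hS, hSaug⟩ := exists_augmentations_of_rare h.hrow h.cardA h.cardB h.rowU hrare
    (by omega) (hM.mono hNM) (hED.mono_right (image_subset_image hNM))
    (hlarge.trans_le (Nat.mul_le_mul_right _ hEcard.ge))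
  by_cases hSP : ∃ y ∈ S, y ∉ P.image Prod.snd
  · obtain ⟨y, hyS, hy⟩ := hSP
    obtain ⟨N', hN'⟩ := (hSaug y hyS).2
    obtain ⟨h3, h4⟩ := hN'.union (P := P) (by rwa [hNP]) hdisj
      (hED.mono_right (image_subset_image hPM)) hy
      ((image_subset_image hPM₀).trans subset_union_right)
    refine ⟨N' ∪ P, h3, notMem_of_colors_subset hN'.colors subset_union_left
      (fun p hp => hMU p (hNM hp)) (fun p hp => hMU p (hPM hp)), by omega, ?_⟩
    refine (card_le_card ?_).trans (Nat.le_add_right _ 2)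
    rw [hM₀P]
    exact sdiff_subset_sdiff subset_rfl subset_union_right
  push Not at hSP
  -- At most 10w cells of M₀ are lost and switching misses 4w columns, hence 14w.
  obtain ⟨⟨x, y⟩, hpP, hxX, hyS, hxM⟩ := h.exists_good_cell hMn hPM₀ hSP (by omega)
  obtain ⟨N₁, hN₁⟩ := (hSaug y hyS).2
  set P₁ := P.erase (x, y) with hP₁
  have hP₁P : P₁ ⊆ P := erase_subset _ _
  have hP₁card : #P₁ + 1 = #P := card_erase_add_one hpP
  have hPR : IsRainbow c P := hM.mono hPM
  have hxP₁ : x ∉ P₁.image Prod.fst := hPR.fst_notMem_image_erase hpP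
  have hyP₁ : y ∉ P₁.image Prod.snd := hPR.snd_notMem_image_erase hpP
  obtain ⟨hM₁, hM₁card⟩ := hN₁.union (P := P₁)
    (hM.mono (union_subset hNM (hP₁P.trans hPM))) (hdisj.mono_right hP₁P)
    (hED.mono_right (image_subset_image (hP₁P.trans hPM))) hyP₁
    ((image_subset_image (hP₁P.trans hPM₀)).trans subset_union_right)
  have hM₁U : ∀ p ∈ N₁ ∪ P₁, c p ∉ U := notMem_of_colors_subset hN₁.colors subset_union_left
      (fun p hp => hMU p (hNM hp)) (fun p hp => hMU p (hPM (hP₁P hp)))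
  have hN₁P₁ : Disjoint N₁ P₁ := by
    refine card_union_eq_card_add_card.1 ?_
    rw [hM₁card, hN₁.card_eq]
  set L : Finset B := {y' ∈ Y | (x, y') ∈ H} with hL
  -- The colours of H in row x are forbidden as well, so that the second switching cannot use up the
  -- colour of the link. They too are rare, and R still has at most 2n colours.
  set R : Finset α := M₀.image c ∪ L.image fun y' => c (x, y') with hR
  have hRrare : ∀ γ ∈ R, #{p | c p = γ} ≤ K := by
    intro γ hγ
    rcases mem_union.1 hγ with hγ | hγ
    · exact hrare γ hγ
    · obtain ⟨y', hy', rfl⟩ := mem_image.1 hγ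
      exact h.rare _ (mem_filter.1 hy').2
  have hRcard : #R ≤ 2 * n := by
    refine (card_union_le _ _).trans ?_
    have h1 : #(L.image fun y' => c (x, y')) ≤ n :=
      card_image_le.trans (h.cardB ▸ card_le_univ _)
    omega
  have hyM : y ∈ M.image Prod.snd := mem_image_of_mem Prod.snd (hPM hpP)
  have hxM' : x ∈ M.image Prod.fst := mem_image_of_mem Prod.fst (hPM hpP)
  have hcolsN₁ : N₁.image Prod.snd ⊆ M.image Prod.snd := by
    rw [hN₁.cols]
    exact insert_subset hyM (image_subset_image hNM)
  obtain ⟨S', hS', hSaug'⟩ := exists_colAugmentations_of_rare h.hcol h.cardA h.cardB h.colU hRrare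
    hRcard hN₁.rainbow (hE'D.mono_right hcolsN₁)
    (hlarge.trans_le (Nat.mul_le_mul_right _ hE'card.ge))
  have hP₁R : P₁.image c ⊆ U ∪ R := (image_subset_image (hP₁P.trans hPM₀)).trans
    (subset_union_left.trans subset_union_right)
  have hN₁U : ∀ p ∈ N₁, c p ∉ U := fun p hp => hM₁U p (mem_union_left _ hp)
  have hP₁U : ∀ p ∈ P₁, c p ∉ U := fun p hp => hM₁U p (mem_union_right _ hp)
  by_cases hSP' : ∃ x' ∈ S', x' ∉ P₁.image Prod.fst
  · obtain ⟨x', hxS', hx'⟩ := hSP'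
    obtain ⟨N₂, hN₂⟩ := (hSaug' x' hxS').2
    obtain ⟨h3, h4⟩ := hN₂.union hM₁ hN₁P₁
      (hE'D.mono_right (image_subset_image (hP₁P.trans hPM))) hx' hP₁R
    refine ⟨N₂ ∪ P₁, h3, notMem_of_colors_subset hN₂.colors subset_union_left hN₁U hP₁U,
      by have := hN₁.card_eq; omega, ?_⟩
    have h5 : M₀ \ (N₂ ∪ P₁) ⊆ insert (x, y) (M₀ \ M) := by
      rw [hM₀P]
      intro p hp
      simp only [hP₁, mem_sdiff, mem_union, mem_erase, mem_insert] at hp ⊢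
      tauto
    have h6 := (card_le_card h5).trans (card_insert_le _ _)
    omega
  push Not at hSP'
  have hN₁card := hN₁.card_eq
  obtain ⟨u, hu, hN₁c⟩ := hN₁.colors
  -- The bound is 15w instead of 14w because N₁ has one more cell than N. Of the 20w cells of H in
  -- row x, at most 15w + w + 1 are excluded; the 1 stands for the colour u brought in by the first
  -- switching.
  obtain ⟨⟨x', y'⟩, hpP₁, hxS', hyY', hH, hcM, hcu⟩ := h.exists_link (hP₁P.trans hPM₀) hSP'
    (by have := h.w_pos; omega) hxX u hxM
  simp only at hxS' hyY' hH hcM hcu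
  obtain ⟨N₂, hN₂⟩ := (hSaug' x' hxS').2
  set P₂ := P₁.erase (x', y') with hP₂
  have hP₂P₁ : P₂ ⊆ P₁ := erase_subset _ _
  have hP₂card : #P₂ + 1 = #P₁ := card_erase_add_one hpP₁
  have hP₁R' : IsRainbow c P₁ := hPR.mono hP₁P
  obtain ⟨hM₂, hM₂card⟩ := hN₂.union (P := P₂) (hM₁.mono (union_subset_union_right hP₂P₁))
    (hN₁P₁.mono_right hP₂P₁) (hE'D.mono_right (image_subset_image (hP₂P₁.trans (hP₁P.trans hPM))))
    (hP₁R'.fst_notMem_image_erase hpP₁) ((image_subset_image hP₂P₁).trans hP₁R)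
  have hM₂U : ∀ p ∈ N₂ ∪ P₂, c p ∉ U :=
    notMem_of_colors_subset hN₂.colors subset_union_left hN₁U
      (fun p hp => hP₁U p (hP₂P₁ hp))
  have hyP₁' : y' ∈ P₁.image Prod.snd := mem_image_of_mem Prod.snd hpP₁
  have hnot : ∀ p ∈ P, ∀ q ∈ N, p.1 ≠ q.1 ∧ p.2 ≠ q.2 := by
    refine fun p hp q hq => ⟨fun e => ?_, fun e => ?_⟩
    · exact disjoint_left.1 hdisj hq (hM.injOn_fst (hPM hp) (hNM hq) e ▸ hp)
    · exact disjoint_left.1 hdisj hq (hM.injOn_snd (hPM hp) (hNM hq) e ▸ hp)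
  have hxN₁ : x ∉ N₁.image Prod.fst := by
    intro hx
    rcases mem_union.1 (hN₁.rows hx) with hx | hx
    · obtain ⟨q, hq, e⟩ := mem_image.1 hx
      exact (hnot _ hpP q hq).1 e.symm
    · exact disjoint_left.1 hED hx hxM'
  have hx₂ : x ∉ (N₂ ∪ P₂).image Prod.fst := by
    rw [image_union, mem_union, hN₂.rows, mem_insert, not_or, not_or]
    refine ⟨⟨?_, hxN₁⟩, fun hx => hxP₁ (image_subset_image hP₂P₁ hx)⟩
    rintro rfl
    exact hxP₁ (mem_image_of_mem Prod.fst hpP₁)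
  have hy₂ : y' ∉ (N₂ ∪ P₂).image Prod.snd := by
    rw [image_union, mem_union, not_or]
    refine ⟨fun hy => ?_, hP₁R'.snd_notMem_image_erase hpP₁⟩
    rcases mem_union.1 (hN₂.cols hy) with hy | hy
    · rw [hN₁.cols, mem_insert] at hy
      rcases hy with rfl | hy
      · exact hyP₁ hyP₁'
      · obtain ⟨q, hq, e⟩ := mem_image.1 hy
        exact (hnot _ (hP₁P hpP₁) q hq).2 e.symm
    · exact disjoint_left.1 hE'D hy (image_subset_image (hP₁P.trans hPM) hyP₁')
  have hc₂ : c (x, y') ∉ (N₂ ∪ P₂).image c := by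
    rw [image_union, mem_union, not_or]
    refine ⟨fun hc => ?_, fun hc => hcM (image_subset_image (hP₂P₁.trans (hP₁P.trans hPM)) hc)⟩
    obtain ⟨v, hv, hN₂c⟩ := hN₂.colors
    rcases mem_insert.1 (hN₂c hc) with e | hc
    · refine hv (e ▸ mem_union_right _ (mem_union_right _ ?_))
      exact mem_image_of_mem (fun y' => c (x, y')) (mem_filter.2 ⟨hyY', hH⟩)
    · rcases mem_insert.1 (hN₁c hc) with e | hc
      · exact hcu e
      · exact hcM (image_subset_image hNM hc)
  refine ⟨insert (x, y') (N₂ ∪ P₂), hM₂.insert hx₂ hy₂ hc₂, ?_, ?_, ?_⟩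
  · intro p hp
    rcases mem_insert.1 hp with rfl | hp
    · exact h.notMem _ hH
    · exact hM₂U p hp
  · rw [card_insert_of_notMem (fun hh => hx₂ (mem_image_of_mem Prod.fst hh)), hM₂card]
    omega
  · have h5 : M₀ \ insert (x, y') (N₂ ∪ P₂) ⊆ insert (x, y) (insert (x', y') (M₀ \ M)) := by
      rw [hM₀P]
      intro p hp
      simp only [hP₂, hP₁, mem_sdiff, mem_union, mem_erase, mem_insert] at hp ⊢
      tauto
    have h6 := (card_le_card h5).trans (card_insert_le _ _)
    have h7 := card_insert_le (x', y') (M₀ \ M)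
    omega

/-- There is an almost perfect rainbow matching that avoids `U`. -/
theorem IsLinkedSystem.exists_almost_perfect (h : IsLinkedSystem c n K w U H M₀ X Y)
    (hw : n * (2 * K + 1) < 5 * w * w) :
    ∃ M, IsRainbow c M ∧ (∀ p ∈ M, c p ∉ U) ∧ (n - #M) * w ≤ n * (2 * K + 1) := by
  obtain ⟨M₁, h1, h2, h3, h4⟩ := h.exists_initial hw
  -- The start lacks at most 5w rows, and each round gains one cell while losing at most two of M₀;
  -- the total loss stays within the 10w that `exists_augmentation` tolerates.
  have key : ∀ i, i ≤ 5 * w → (∃ M, IsRainbow c M ∧ (∀ p ∈ M, c p ∉ U) ∧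
      (n - #M) * w ≤ n * (2 * K + 1)) ∨ ∃ M, IsRainbow c M ∧ (∀ p ∈ M, c p ∉ U) ∧
      n + i ≤ #M + 5 * w ∧ #(M₀ \ M) ≤ 2 * i := by
    intro i
    induction i with
    | zero => exact fun _ => Or.inr ⟨M₁, h2, h3, by omega, by simp [sdiff_eq_empty_iff_subset.2 h1]⟩
    | succ i ih =>
      intro hi
      rcases ih (by omega) with hdone | ⟨M, hM, hMU, hcard, hlost⟩
      · exact Or.inl hdone
      · rcases le_or_gt ((n - #M) * w) (n * (2 * K + 1)) with hle | hlt
        · exact Or.inl ⟨M, hM, hMU, hle⟩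
        · obtain ⟨M', k1, k2, k3, k4⟩ := h.exists_augmentation hM hMU (by omega) hlt
          exact Or.inr ⟨M', k1, k2, by omega, by omega⟩
  rcases key (5 * w) le_rfl with hdone | ⟨M, hM, hMU, hcard, -⟩
  · exact hdone
  · refine ⟨M, hM, hMU, ?_⟩
    rw [Nat.sub_eq_zero_of_le (by omega), zero_mul]
    exact Nat.zero_le _

end Phases

/-! ### Completing the matching with reserve colours. -/

section Expander

variable {A B α : Type*} [DecidableEq A] [DecidableEq B] [DecidableEq α] [Fintype A] [Fintype B]
  {c : A × B → α}

/-- Matches one more row and one more column by means of three cells with colours of `U`. -/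
theorem exists_augmentation_of_expander
    (hrow : ∀ a b b', c (a, b) = c (a, b') → b = b')
    (hcol : ∀ a a' b, c (a, b) = c (a', b) → a = a') {n : ℕ} (hA : Fintype.card A = n)
    (hB : Fintype.card B = n) {U : Finset α} {r z k : ℕ} {M : Finset (A × B)} (hM : IsRainbow c M)
    (hz : #(M.image c ∩ U) ≤ z) (hk : #M + k = n) (hkpos : 0 < k)
    (hrowU : ∀ a, r + z + k ≤ #{b | c (a, b) ∈ U}) (hcolU : ∀ b, r + z + k ≤ #{a | c (a, b) ∈ U})
    (hrect : ∀ X Y, r ≤ #X → r ≤ #Y → (z + 4) * n < #{p ∈ X ×ˢ Y | c p ∈ U}) :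
    ∃ M', IsRainbow c M' ∧ #M' = #M + 1 ∧ #(M'.image c ∩ U) ≤ z + 3 := by
  obtain ⟨a, ha⟩ : ∃ a, a ∉ M.image Prod.fst := by
    by_contra! hcon
    have := card_le_card (show univ ⊆ M.image Prod.fst from fun a _ => hcon a)
    rw [card_univ, hM.card_image_fst] at this
    omega
  obtain ⟨b, hb⟩ : ∃ b, b ∉ M.image Prod.snd := by
    by_contra! hcon
    have := card_le_card (show univ ⊆ M.image Prod.snd from fun a _ => hcon a)
    rw [card_univ, hM.card_image_snd] at this
    omega
  set W := M.image c ∩ U with hW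
  -- Cells of M whose column can be taken over by the free row a, using an unused colour of U; T
  -- plays the same role for the free column b.
  set S : Finset (A × B) := {p ∈ M | c (a, p.2) ∈ U \ M.image c} with hS
  set T : Finset (A × B) := {p ∈ M | c (p.1, b) ∈ U \ M.image c} with hT
  have hSM : S ⊆ M := filter_subset _ _
  have hTM : T ⊆ M := filter_subset _ _
  have hScard : r ≤ #(S.image Prod.fst) := by
    rw [(hM.mono hSM).card_image_fst, ← (hM.mono hSM).card_image_snd]
    have h1 : ({y | c (a, y) ∈ U} : Finset B) ⊆
        S.image Prod.snd ∪ (({y | c (a, y) ∈ W} : Finset B) ∪ (univ \ M.image Prod.snd)) := by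
      intro y hy
      have hyU := (mem_filter.1 hy).2
      by_cases hyM : y ∈ M.image Prod.snd
      · obtain ⟨p, hp, rfl⟩ := mem_image.1 hyM
        by_cases hc : c (a, p.2) ∈ M.image c
        · exact mem_union_right _ (mem_union_left _
            (mem_filter.2 ⟨mem_univ _, mem_inter.2 ⟨hc, hyU⟩⟩))
        · exact mem_union_left _ (mem_image_of_mem _
            (mem_filter.2 ⟨hp, mem_sdiff.2 ⟨hyU, hc⟩⟩))
      · exact mem_union_right _ (mem_union_right _ (mem_sdiff.2 ⟨mem_univ _, hyM⟩))
    have h2 := (card_le_card h1).trans ((card_union_le _ _).trans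
      (Nat.add_le_add_left (card_union_le _ _) _))
    have h3 : #{y | c (a, y) ∈ W} ≤ #W :=
      card_le_card_of_injOn (fun y => c (a, y)) (fun y hy => (mem_filter.1 hy).2)
        (fun y _ y' _ e => hrow a y y' e)
    have h4 : #(univ \ M.image Prod.snd) = n - #M := by
      rw [card_sdiff_of_subset (subset_univ _), hM.card_image_snd, card_univ, hB]
    have := hrowU a
    omega
  have hTcard : r ≤ #(T.image Prod.snd) := by
    rw [(hM.mono hTM).card_image_snd, ← (hM.mono hTM).card_image_fst]
    have h1 : ({x | c (x, b) ∈ U} : Finset A) ⊆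
        T.image Prod.fst ∪ (({x | c (x, b) ∈ W} : Finset A) ∪ (univ \ M.image Prod.fst)) := by
      intro x hx
      have hxU := (mem_filter.1 hx).2
      by_cases hxM : x ∈ M.image Prod.fst
      · obtain ⟨p, hp, rfl⟩ := mem_image.1 hxM
        by_cases hc : c (p.1, b) ∈ M.image c
        · exact mem_union_right _ (mem_union_left _
            (mem_filter.2 ⟨mem_univ _, mem_inter.2 ⟨hc, hxU⟩⟩))
        · exact mem_union_left _ (mem_image_of_mem _
            (mem_filter.2 ⟨hp, mem_sdiff.2 ⟨hxU, hc⟩⟩))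
      · exact mem_union_right _ (mem_union_right _ (mem_sdiff.2 ⟨mem_univ _, hxM⟩))
    have h2 := (card_le_card h1).trans ((card_union_le _ _).trans
      (Nat.add_le_add_left (card_union_le _ _) _))
    have h3 : #{x | c (x, b) ∈ W} ≤ #W :=
      card_le_card_of_injOn (fun x => c (x, b)) (fun x hx => (mem_filter.1 hx).2)
        (fun x _ x' _ e => hcol x x' b e)
    have h4 : #(univ \ M.image Prod.fst) = n - #M := by
      rw [card_sdiff_of_subset (subset_univ _), hM.card_image_fst, card_univ, hA]
    have := hcolU b
    omega
  classical
  -- Bad choices for the middle cell: its colour is already used, equals the colour of one of the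
  -- two outer cells, or the outer cells themselves share a colour. With M, which would make the two
  -- deleted cells coincide, they number at most (z + 4)n.
  set B₁ : Finset (A × B) := {p | c p ∈ W} with hB₁
  set B₂ : Finset (A × B) := {p | ∃ y, (p.1, y) ∈ M ∧ c (a, y) = c p} with hB₂
  set B₃ : Finset (A × B) := {p | ∃ x, (x, p.2) ∈ M ∧ c (x, b) = c p} with hB₃
  set B₄ : Finset (A × B) := {p | ∃ y x, (p.1, y) ∈ M ∧ (x, p.2) ∈ M ∧ c (a, y) = c (x, b)} with hB₄
  have hB₁card : #B₁ ≤ z * n := by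
    have h1 : #B₁ ≤ #(W ×ˢ (univ : Finset A)) := by
      refine card_le_card_of_injOn (fun p => (c p, p.1))
        (fun p hp => mem_product.2 ⟨(mem_filter.1 hp).2, mem_univ _⟩) ?_
      rintro ⟨x, y⟩ _ ⟨x', y'⟩ _ e
      simp only [Prod.mk.injEq] at e
      obtain ⟨e1, rfl⟩ := e
      rw [hrow _ _ _ e1]
    rw [card_product, card_univ, hA] at h1
    exact h1.trans (Nat.mul_le_mul_right _ hz)
  have hMn : #M ≤ n := by omega
  have hB₂card : #B₂ ≤ n := by
    rw [← hA, ← card_univ]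
    refine card_le_card_of_injOn Prod.fst (fun p _ => mem_coe.2 (mem_univ _)) ?_
    rintro ⟨x, y⟩ hp ⟨x', y'⟩ hp' (rfl : x = x')
    obtain ⟨-, v, hv, e⟩ := mem_filter.1 hp
    obtain ⟨-, v', hv', e'⟩ := mem_filter.1 hp'
    have hvv : v = v' := congrArg Prod.snd (hM.injOn_fst hv hv' rfl)
    subst hvv
    rw [hrow x y y' (e.symm.trans e')]
  have hB₃card : #B₃ ≤ n := by
    rw [← hB, ← card_univ]
    refine card_le_card_of_injOn Prod.snd (fun p _ => mem_coe.2 (mem_univ _)) ?_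
    rintro ⟨x, y⟩ hp ⟨x', y'⟩ hp' (rfl : y = y')
    obtain ⟨-, v, hv, e⟩ := mem_filter.1 hp
    obtain ⟨-, v', hv', e'⟩ := mem_filter.1 hp'
    have hvv : v = v' := congrArg Prod.fst (hM.injOn_snd hv hv' rfl)
    subst hvv
    rw [hcol x x' y (e.symm.trans e')]
  have hB₄card : #B₄ ≤ n := by
    rw [← hA, ← card_univ]
    refine card_le_card_of_injOn Prod.fst (fun p _ => mem_coe.2 (mem_univ _)) ?_
    rintro ⟨x, y⟩ hp ⟨x', y'⟩ hp' (rfl : x = x')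
    obtain ⟨-, v, u, hv, hu, e⟩ := mem_filter.1 hp
    obtain ⟨-, v', u', hv', hu', e'⟩ := mem_filter.1 hp'
    have hvv : v = v' := congrArg Prod.snd (hM.injOn_fst hv hv' rfl)
    subst hvv
    have huu : u = u' := hcol u u' b (e.symm.trans e')
    subst huu
    have : y = y' := congrArg Prod.snd (hM.injOn_fst hu hu' rfl)
    rw [this]
  obtain ⟨⟨x, y'⟩, hpU, hpB⟩ : ∃ p ∈ ({p ∈ S.image Prod.fst ×ˢ T.image Prod.snd | c p ∈ U} :
      Finset (A × B)), p ∉ B₁ ∪ (B₂ ∪ (B₃ ∪ (B₄ ∪ M))) := by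
    by_contra! hcon
    have h1 := card_le_card (show ({p ∈ S.image Prod.fst ×ˢ T.image Prod.snd | c p ∈ U} :
      Finset (A × B)) ⊆ B₁ ∪ (B₂ ∪ (B₃ ∪ (B₄ ∪ M))) from hcon)
    have h2 := hrect _ _ hScard hTcard
    have h3 := card_union_le B₁ (B₂ ∪ (B₃ ∪ (B₄ ∪ M)))
    have h4 := card_union_le B₂ (B₃ ∪ (B₄ ∪ M))
    have h5 := card_union_le B₃ (B₄ ∪ M)
    have h6 := card_union_le B₄ M
    rw [add_mul] at h2
    omega
  obtain ⟨hpST, hcU⟩ := mem_filter.1 hpU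
  obtain ⟨hxS, hyT⟩ := mem_product.1 hpST
  obtain ⟨⟨x₀, y⟩, hxy, rfl⟩ := mem_image.1 hxS
  obtain ⟨⟨x', y₀⟩, hxy', rfl⟩ := mem_image.1 hyT
  simp only [mem_union, not_or, hB₁, hB₂, hB₃, hB₄, mem_filter, mem_univ, true_and, not_exists,
    not_and] at hpB hcU
  obtain ⟨n1, n2, n3, n4, n5⟩ := hpB
  obtain ⟨hxyM, hcay⟩ := mem_filter.1 hxy
  obtain ⟨hxyM', hcxb⟩ := mem_filter.1 hxy'
  simp only at hcay hcxb
  obtain ⟨hcayU, hcayM⟩ := mem_sdiff.1 hcay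
  obtain ⟨hcxbU, hcxbM⟩ := mem_sdiff.1 hcxb
  have hcM : c (x₀, y₀) ∉ M.image c := fun hh => n1 (mem_inter.2 ⟨hh, hcU⟩)
  have hne : (x', y₀) ≠ (x₀, y) := by
    intro e
    rw [Prod.mk.injEq] at e
    exact n5 (e.1 ▸ hxyM')
  have hxne : x₀ ≠ x' := fun e => n5 (e ▸ hxyM')
  have hyne : y₀ ≠ y := fun e => n5 (e ▸ hxyM)
  have hax : a ≠ x₀ := fun e => ha (e ▸ mem_image_of_mem Prod.fst hxyM)
  have hax' : a ≠ x' := fun e => ha (e ▸ mem_image_of_mem Prod.fst hxyM')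
  have hby : b ≠ y := fun e => hb (e ▸ mem_image_of_mem Prod.snd hxyM)
  have hby' : b ≠ y₀ := fun e => hb (e ▸ mem_image_of_mem Prod.snd hxyM')
  set M₁ := (M.erase (x₀, y)).erase (x', y₀) with hM₁
  have hM₁M : M₁ ⊆ M := (erase_subset _ _).trans (erase_subset _ _)
  have hM₁card : #M₁ + 2 = #M := by
    have h1 := card_erase_add_one hxyM
    have h2 := card_erase_add_one (mem_erase.2 ⟨hne, hxyM'⟩)
    rw [← hM₁] at h2
    omega
  have hx₁ : x₀ ∉ M₁.image Prod.fst := fun hh =>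
    hM.fst_notMem_image_erase hxyM (image_subset_image (erase_subset _ _) hh)
  have hy₁ : y ∉ M₁.image Prod.snd := fun hh =>
    hM.snd_notMem_image_erase hxyM (image_subset_image (erase_subset _ _) hh)
  have hMe : IsRainbow c (M.erase (x₀, y)) := hM.mono (erase_subset _ _)
  have hx₁' : x' ∉ M₁.image Prod.fst := hMe.fst_notMem_image_erase (mem_erase.2 ⟨hne, hxyM'⟩)
  have hy₁' : y₀ ∉ M₁.image Prod.snd := hMe.snd_notMem_image_erase (mem_erase.2 ⟨hne, hxyM'⟩)
  have ha₁ : a ∉ M₁.image Prod.fst := fun hh => ha (image_subset_image hM₁M hh)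
  have hb₁ : b ∉ M₁.image Prod.snd := fun hh => hb (image_subset_image hM₁M hh)
  have r1 : IsRainbow c (insert (x', b) M₁) := (hM.mono hM₁M).insert hx₁' hb₁
    (fun hh => hcxbM (image_subset_image hM₁M hh))
  have r2 : IsRainbow c (insert (x₀, y₀) (insert (x', b) M₁)) := by
    refine r1.insert ?_ ?_ ?_
    · rw [image_insert, mem_insert, not_or]; exact ⟨hxne, hx₁⟩
    · rw [image_insert, mem_insert, not_or]; exact ⟨hby'.symm, hy₁'⟩
    · rw [image_insert, mem_insert, not_or]
      exact ⟨fun e => n3 x' hxyM' e.symm, fun hh => hcM (image_subset_image hM₁M hh)⟩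
  have ha₂ : a ∉ (insert (x₀, y₀) (insert (x', b) M₁)).image Prod.fst := by
    simp only [image_insert, mem_insert, not_or]; exact ⟨hax, hax', ha₁⟩
  have r3 : IsRainbow c (insert (a, y) (insert (x₀, y₀) (insert (x', b) M₁))) := by
    refine r2.insert ha₂ ?_ ?_
    · simp only [image_insert, mem_insert, not_or]; exact ⟨hyne.symm, hby.symm, hy₁⟩
    · simp only [image_insert, mem_insert, not_or]
      exact ⟨n2 y hxyM, n4 y x' hxyM hxyM', fun hh => hcayM (image_subset_image hM₁M hh)⟩
  refine ⟨_, r3, ?_, ?_⟩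
  · rw [← r3.card_image_snd, image_insert, card_insert_of_notMem, image_insert,
      card_insert_of_notMem, image_insert, card_insert_of_notMem hb₁,
      (hM.mono hM₁M).card_image_snd]
    · omega
    · rw [image_insert, mem_insert, not_or]; exact ⟨hby'.symm, hy₁'⟩
    · simp only [image_insert, mem_insert, not_or]; exact ⟨hyne.symm, hby.symm, hy₁⟩
  · have hsub : (insert (a, y) (insert (x₀, y₀) (insert (x', b) M₁))).image c ∩ U ⊆
        insert (c (a, y)) (insert (c (x₀, y₀)) (insert (c (x', b)) W)) := by
      intro γ hγ
      have hM₁c := image_subset_image (f := c) hM₁M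
      simp only [image_insert, mem_inter, mem_insert] at hγ
      simp only [mem_insert, hW, mem_inter]
      rcases hγ with ⟨e | e | e | e, hU⟩
      · exact Or.inl e
      · exact Or.inr (Or.inl e)
      · exact Or.inr (Or.inr (Or.inl e))
      · exact Or.inr (Or.inr (Or.inr ⟨hM₁c e, hU⟩))
    refine (card_le_card hsub).trans ?_
    have h1 := card_insert_le (c (a, y)) (insert (c (x₀, y₀)) (insert (c (x', b)) W))
    have h2 := card_insert_le (c (x₀, y₀)) (insert (c (x', b)) W)
    have h3 := card_insert_le (c (x', b)) W
    omega

/-- Each augmentation lowers k by one and raises z by at most three, so conditions stated through z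
+ 3k survive the induction. -/
theorem exists_perfect_of_expander (hrow : ∀ a b b', c (a, b) = c (a, b') → b = b')
    (hcol : ∀ a a' b, c (a, b) = c (a', b) → a = a') {n : ℕ} (hA : Fintype.card A = n)
    (hB : Fintype.card B = n) {U : Finset α} {r : ℕ} (k : ℕ) :
    ∀ (z : ℕ) (M : Finset (A × B)), IsRainbow c M → #(M.image c ∩ U) ≤ z → #M + k = n →
    (∀ a, r + z + 3 * k ≤ #{b | c (a, b) ∈ U}) → (∀ b, r + z + 3 * k ≤ #{a | c (a, b) ∈ U}) →
    (∀ X Y, r ≤ #X → r ≤ #Y → (z + 3 * k + 4) * n < #{p ∈ X ×ˢ Y | c p ∈ U}) →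
    ∃ M', IsRainbow c M' ∧ #M' = n := by
  induction k with
  | zero => exact fun z M hM _ hk _ _ _ => ⟨M, hM, hk⟩
  | succ k ih =>
    intro z M hM hz hk hrowU hcolU hrect
    obtain ⟨M', h1, h2, h3⟩ := exists_augmentation_of_expander hrow hcol hA hB hM hz hk (by omega)
      (r := r) (fun a => by have := hrowU a; omega) (fun b => by have := hcolU b; omega)
      (fun X Y hX hY => (Nat.mul_le_mul_right n (by omega)).trans_lt (hrect X Y hX hY))
    exact ih (z + 3) M' h1 h3 (by omega) (fun a => (by omega : _ ≤ _).trans (hrowU a))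
      (fun b => (by omega : _ ≤ _).trans (hcolU b))
      (fun X Y hX hY => (Nat.mul_le_mul_right n (by omega)).trans_lt (hrect X Y hX hY))

end Expander

/-! ### Choice of constants and the main theorem for arrays. -/

lemma abs_le_of_pow_four_le {x y : ℝ} (hy : 0 ≤ y) (h : x ^ 4 ≤ y ^ 4) : |x| ≤ y := by
  rw [← Even.pow_abs (by decide : Even 4) x] at h
  exact le_of_pow_le_pow_left₀ (by norm_num) hy h

set_option maxHeartbeats 2000000 in
/-- A proper colouring of the cells of a large square with sufficiently many colours has a perfect
rainbow matching. -/
theorem exists_perfect_rainbow {A B α : Type*} [DecidableEq A] [DecidableEq B] [DecidableEq α]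
    [Fintype A] [Fintype B] {c : A × B → α} (hrow : ∀ a b b', c (a, b) = c (a, b') → b = b')
    (hcol : ∀ a a' b, c (a, b) = c (a', b) → a = a') {n : ℕ} (hA : Fintype.card A = n)
    (hB : Fintype.card B = n) {d : ℝ} (hd : 0 < d) (hd1 : d ≤ 1)
    (hn : 10 ^ 8 ≤ n * (d ^ 2 / 64000) ^ 12) (hcolors : d * n ^ 2 ≤ #(univ.image c)) :
    ∃ M, IsRainbow c M ∧ #M = n := by
  -- The constant makes 20wn ≤ t² hold below: w ≤ 2μn = d²n/32000, while t ≥ dn/40.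
  obtain ⟨μ, hμ⟩ : ∃ μ, μ = d ^ 2 / 64000 := ⟨_, rfl⟩
  rw [← hμ] at hn
  have hμ0 : 0 < μ := by rw [hμ]; positivity
  have hd2 : d ^ 2 ≤ d := by nlinarith
  have hμd : μ ≤ d := by rw [hμ]; linarith
  have hμ4 : μ ≤ 1 / 64000 := by rw [hμ]; linarith
  have hμ1 : μ ≤ 1 := by linarith
  have hn0 : (0 : ℝ) < n := by
    rcases (Nat.cast_nonneg n : (0 : ℝ) ≤ n).eq_or_lt with h | h
    · rw [← h] at hn; norm_num at hn
    · exact h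
  have hpow : ∀ j ≤ 12, 10 ^ 8 ≤ n * μ ^ j := fun j hj => hn.trans
    (mul_le_mul_of_nonneg_left (pow_le_pow_of_le_one hμ0.le hμ1 hj) hn0.le)
  have p1 := hpow 1 (by norm_num)
  have p2 := hpow 2 (by norm_num)
  have p3 := hpow 3 (by norm_num)
  have p4 := hpow 4 (by norm_num)
  have p5 := hpow 5 (by norm_num)
  rw [pow_one] at p1
  obtain ⟨U, -, hUcard, hU⟩ := exists_isReserve (Γ := univ.image c) hμ0
    (by linarith : μ < 1) (fun p => mem_image_of_mem c (mem_univ p)) hrow hcol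
    (Nat.cast_pos.1 hn0) hA hB
  have hn3 : 18 * (n : ℝ) ^ 3 ≤ (μ * n / 2) ^ 4 := by
    have : (μ * n / 2) ^ 4 = (n * μ ^ 4) * n ^ 3 / 16 := by ring
    rw [this]
    have : 0 < (n : ℝ) ^ 3 := by positivity
    nlinarith
  have hrowU := fun a => abs_le.1 (abs_le_of_pow_four_le (by positivity) ((hU.row a).trans hn3))
  have hcolU := fun b => abs_le.1 (abs_le_of_pow_four_le (by positivity) ((hU.col b).trans hn3))
  obtain ⟨w, hw⟩ : ∃ w : ℕ, w = ⌈μ * n⌉₊ := ⟨_, rfl⟩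
  have hw1 : μ * n ≤ w := hw ▸ Nat.le_ceil _
  have hw2 : (w : ℝ) ≤ 2 * (μ * n) := by
    have := Nat.ceil_lt_add_one (show 0 ≤ μ * n by positivity)
    rw [← hw] at this
    linarith
  -- At most n²/K ≤ dn²/4 colours have more than K cells, and U takes at most half of all colours,
  -- so dn²/4 rare colours remain.
  obtain ⟨K, hK⟩ : ∃ K : ℕ, K = ⌈4 / d⌉₊ := ⟨_, rfl⟩
  have hK1 : 4 / d ≤ K := hK ▸ Nat.le_ceil _
  have hK2 : (2 * K + 1 : ℝ) ≤ 11 / d := by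
    have h1 := Nat.ceil_lt_add_one (show 0 ≤ 4 / d by positivity)
    rw [← hK] at h1
    have h2 : 1 ≤ 1 / d := by rw [le_div_iff₀ hd]; linarith
    have h3 : 11 / d = 2 * (4 / d) + 3 * (1 / d) := by ring
    linarith
  obtain ⟨H, hHinj, hHU, hHrare, hHcard⟩ := exists_rare_cells c U K
  have hHcard' : d * (n : ℝ) ^ 2 / 4 ≤ #H := by
    rw [hA, hB] at hHcard
    have h1 : (#(univ.image c) : ℝ) * K ≤ #H * K + #U * K + n * n := by exact_mod_cast hHcard
    have hK0 : (0 : ℝ) < K := lt_of_lt_of_le (by positivity) hK1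
    have h2 : (n : ℝ) * n ≤ d * n ^ 2 / 4 * K := by
      have h3 : 1 ≤ d / 4 * K := by
        rw [div_le_iff₀ hd] at hK1
        linarith
      have h4 : 0 ≤ (n : ℝ) ^ 2 := by positivity
      nlinarith
    have h5 : (#U : ℝ) ≤ #(univ.image c) / 2 := by
      have h6 : (0 : ℝ) ≤ #(univ.image c) := Nat.cast_nonneg _
      nlinarith
    refine le_of_mul_le_mul_right ?_ hK0
    have h7 : (#U : ℝ) * K ≤ #(univ.image c) / 2 * K := mul_le_mul_of_nonneg_right h5 hK0.le
    have h8 : d * (n : ℝ) ^ 2 * K ≤ #(univ.image c) * K :=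
      mul_le_mul_of_nonneg_right hcolors hK0.le
    linarith
  -- The value 1/20 turns 5tn ≤ |H| into the bound dn²/4 just obtained.
  obtain ⟨t, ht⟩ : ∃ t : ℕ, t = ⌊d * n / 20⌋₊ := ⟨_, rfl⟩
  have ht1 : (t : ℝ) ≤ d * n / 20 := ht ▸ Nat.floor_le (by positivity)
  have hdn : 10 ^ 8 ≤ d * n := by nlinarith
  have ht2 : d * n / 40 ≤ t := by
    have := Nat.lt_floor_add_one (d * n / 20)
    rw [← ht] at this
    linarith
  have hwd : (w : ℝ) ≤ d ^ 2 * n / 32000 := by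
    rw [hμ] at hw2; linarith
  obtain ⟨X, Y, M₀, hM₀H, hM₀, hXcard, hX, hY, hXY⟩ := exists_linked_matching hHinj (n := n)
    (t := t) (q := 20 * w) (Nat.cast_pos.1 hn0) hA hB (by
      have : (5 * t * n : ℝ) ≤ #H := by
        refine le_trans ?_ hHcard'
        nlinarith
      exact_mod_cast this) (by
      have : (n * (20 * w) : ℝ) ≤ t * t := by
        have h1 : (d * n / 40) * (d * n / 40) ≤ (t : ℝ) * t :=
          mul_le_mul ht2 ht2 (by positivity) (by positivity)
        nlinarith
      exact_mod_cast this)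
  have hw0 : 0 < w := by
    have : (0 : ℝ) < w := lt_of_lt_of_le (by positivity) hw1
    exact_mod_cast this
  have hsys : IsLinkedSystem c n K w U H M₀ X Y :=
    { cardA := hA
      cardB := hB
      hrow := hrow
      hcol := hcol
      rowU := fun a => by
        have : (#{b | c (a, b) ∈ U} : ℝ) ≤ 2 * w := by linarith [(hrowU a).2]
        exact_mod_cast this
      colU := fun b => by
        have : (#{a | c (a, b) ∈ U} : ℝ) ≤ 2 * w := by linarith [(hcolU b).2]
        exact_mod_cast this
      w_pos := hw0
      injOn := hHinj
      notMem := hHU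
      rare := hHrare
      subset := hM₀H
      rainbow := hM₀
      rows := hX
      cols := hY
      linked := hXY
      size := by
        rw [hXcard]
        have h1 : d * n / 50 ≤ (t : ℝ) - 14 * w := by
          have h2 : d ^ 2 * n ≤ d * n := mul_le_mul_of_nonneg_right hd2 hn0.le
          linarith
        have h3 : (d * n / 50) * (μ * n) ≤ (t - 14 * w) * w :=
          mul_le_mul h1 hw1 (by positivity) (le_trans (by positivity) h1)
        have h4 : (n : ℝ) < (d * n / 50) * (μ * n) := by
          have h5 : (10 : ℝ) ^ 8 ≤ d * (μ * n) := by
            have h6 : μ * (μ * n) ≤ d * (μ * n) := mul_le_mul_of_nonneg_right hμd (by positivity)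
            nlinarith
          nlinarith
        have : (n + 14 * w * w : ℝ) < t * w := by nlinarith
        exact_mod_cast this }
  have hdμn : 10 ^ 8 ≤ d * μ ^ 2 * n := by
    have h6 : μ * (μ ^ 2 * n) ≤ d * (μ ^ 2 * n) := mul_le_mul_of_nonneg_right hμd (by positivity)
    nlinarith
  obtain ⟨M, hM, hMU, hMcard⟩ := hsys.exists_almost_perfect (by
    have h1 : (n * (2 * K + 1) : ℝ) < 5 * w * w := by
      have h2 : (n * (2 * K + 1) : ℝ) ≤ n * (11 / d) := mul_le_mul_of_nonneg_left hK2 hn0.le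
      have h3 : (n * (11 / d) : ℝ) < 5 * (μ * n) * (μ * n) := by
        rw [mul_div_assoc', div_lt_iff₀ hd]
        nlinarith
      have h4 : (μ * n) * (μ * n) ≤ (w : ℝ) * w := mul_le_mul hw1 hw1 (by positivity)
        (by positivity)
      nlinarith
    exact_mod_cast h1)
  have hMn : #M ≤ n := hM.card_le hA
  obtain ⟨k, hk⟩ : ∃ k, k = n - #M := ⟨_, rfl⟩
  rw [← hk] at hMcard
  have hk1 : (k : ℝ) * (d * μ) ≤ 11 := by
    have h1 : (k * w : ℝ) ≤ n * (2 * K + 1) := by exact_mod_cast hMcard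
    have h2 : (k : ℝ) * (μ * n) ≤ n * (11 / d) :=
      (mul_le_mul_of_nonneg_left hw1 (Nat.cast_nonneg k)).trans
        (h1.trans (mul_le_mul_of_nonneg_left hK2 hn0.le))
    have h3 : (k : ℝ) * μ ≤ 11 / d := by
      refine le_of_mul_le_mul_right ?_ hn0
      linarith
    rw [le_div_iff₀ hd] at h3
    linarith
  have hk2 : (k : ℝ) ≤ 11 / (d * μ) := by rwa [le_div_iff₀ (by positivity)]
  have h1dμ : 1 ≤ 1 / (d * μ) := by
    rw [le_div_iff₀ (by positivity), one_mul]
    exact mul_le_one₀ hd1 hμ0.le hμ1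
  have hk3 : (3 * k + 4 : ℝ) ≤ 37 / (d * μ) := by
    have : 37 / (d * μ) = 3 * (11 / (d * μ)) + 4 * (1 / (d * μ)) := by ring
    linarith
  have hk4 : (3 * k + 4 : ℝ) ≤ μ * n / 8 := by
    refine hk3.trans ?_
    rw [div_le_iff₀ (by positivity)]
    nlinarith
  -- Rows and columns contain at least μn/2 cells of the reserve; half of this is for r, the rest
  -- covers the 3k colours that will be consumed.
  obtain ⟨r, hr⟩ : ∃ r : ℕ, r = ⌈μ * n / 4⌉₊ := ⟨_, rfl⟩
  have hr1 : μ * n / 4 ≤ r := hr ▸ Nat.le_ceil _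
  have hr2 : (r : ℝ) + 3 * k ≤ μ * n / 2 := by
    have := Nat.ceil_lt_add_one (show 0 ≤ μ * n / 4 by positivity)
    rw [← hr] at this
    linarith
  refine exists_perfect_of_expander hrow hcol hA hB (U := U) (r := r) k 0 M hM ?_ (by omega)
    ?_ ?_ ?_
  · rw [Nat.le_zero, card_eq_zero, ← disjoint_iff_inter_eq_empty]
    refine disjoint_left.2 fun γ hγ => ?_
    obtain ⟨p, hp, rfl⟩ := mem_image.1 hγ
    exact hMU p hp
  · intro a
    have : (r + 3 * k : ℝ) ≤ #{b | c (a, b) ∈ U} := by linarith [(hrowU a).1]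
    rw [add_zero]
    exact_mod_cast this
  · intro b
    have : (r + 3 * k : ℝ) ≤ #{a | c (a, b) ∈ U} := by linarith [(hcolU b).1]
    rw [add_zero]
    exact_mod_cast this
  · intro X' Y' hX' hY'
    -- An r × r rectangle is expected to hold at least μ³n²/16 reserve cells. Keeping the error
    -- below half of that is what requires nμ¹² to be large.
    have h1 : 18 * (n : ℝ) ^ 7 ≤ (μ ^ 3 * n ^ 2 / 32) ^ 4 := by
      have h2 : (μ ^ 3 * n ^ 2 / 32) ^ 4 = (n * μ ^ 12) * (n : ℝ) ^ 7 / 1048576 := by ring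
      rw [h2]
      have : 0 < (n : ℝ) ^ 7 := by positivity
      nlinarith
    have h3 := (abs_le.1 (abs_le_of_pow_four_le (by positivity) ((hU.rect X' Y').trans h1))).1
    have hX'' : μ * n / 4 ≤ #X' := hr1.trans (by exact_mod_cast hX')
    have hY'' : μ * n / 4 ≤ #Y' := hr1.trans (by exact_mod_cast hY')
    have h4 : (μ * n / 4) * (μ * n / 4) ≤ (#X' : ℝ) * #Y' :=
      mul_le_mul hX'' hY'' (by positivity) (by positivity)
    have h5 : μ ^ 3 * (n : ℝ) ^ 2 / 16 ≤ μ * #X' * #Y' := by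
      have := mul_le_mul_of_nonneg_left h4 hμ0.le
      linarith
    have h6 : (3 * k + 4 : ℝ) * n < μ ^ 3 * n ^ 2 / 32 := by
      have h7 : (3 * k + 4 : ℝ) < μ ^ 3 * n / 32 := by
        refine hk3.trans_lt ?_
        rw [div_lt_iff₀ (by positivity)]
        have h8 : μ * (μ ^ 4 * n) ≤ d * (μ ^ 4 * n) :=
          mul_le_mul_of_nonneg_right hμd (by positivity)
        nlinarith
      have := mul_lt_mul_of_pos_right h7 hn0
      linarith
    have h9 : ((0 + 3 * k + 4 : ℕ) * n : ℝ) < #{p ∈ X' ×ˢ Y' | c p ∈ U} := by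
      push_cast
      linarith
    exact_mod_cast h9

lemma IsLatinArray.exists_isTransversal {n : ℕ} {α : Type*} {L : Matrix (Fin n) (Fin n) α}
    (hL : IsLatinArray L) {d : ℝ} (hd : 0 < d) (hd1 : d ≤ 1)
    (hn : 10 ^ 8 ≤ n * (d ^ 2 / 64000) ^ 12)
    (hcolors : d * n ^ 2 ≤ ((arraySymbols L).ncard : ℝ)) : ∃ T, IsTransversal L T := by
  classical
  have hcard : (arraySymbols L).ncard = #(univ.image fun p : Fin n × Fin n => L p.1 p.2) := by
    rw [arraySymbols, ← Set.ncard_coe_finset, coe_image, coe_univ, Set.image_univ]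
  obtain ⟨M, hM, hMn⟩ := exists_perfect_rainbow (c := fun p : Fin n × Fin n => L p.1 p.2)
    (fun a b b' h => hL.1 a h) (fun a a' b h => hL.2 b h) (Fintype.card_fin n)
    (Fintype.card_fin n) hd hd1 hn (hcard ▸ hcolors)
  have hfst : M.image Prod.fst = univ := by
    rw [← card_eq_iff_eq_univ, hM.card_image_fst, hMn, Fintype.card_fin]
  have hsnd : M.image Prod.snd = univ := by
    rw [← card_eq_iff_eq_univ, hM.card_image_snd, hMn, Fintype.card_fin]
  refine ⟨M, fun i => ?_, fun j => ?_, hM.injOn_color⟩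
  · obtain ⟨p, hp, rfl⟩ := mem_image.1 (hfst ▸ mem_univ i)
    refine ⟨p.2, hp, fun j hj => ?_⟩
    exact congrArg Prod.snd (hM.injOn_fst hj hp rfl)
  · obtain ⟨p, hp, rfl⟩ := mem_image.1 (hsnd ▸ mem_univ j)
    refine ⟨p.1, hp, fun i hi => ?_⟩
    exact congrArg Prod.fst (hM.injOn_snd hi hp rfl)

/-! ### From edge-colourings of the complete bipartite graph to arrays. -/

section Bipartite

variable {n : ℕ} {α : Type*}

lemma cell_mem_edgeSet (i j : Fin n) :
    s(Sum.inl i, Sum.inr j) ∈ (completeBipartiteGraph (Fin n) (Fin n)).edgeSet := by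
  simp

/-- The array of colours of an edge-coloured complete bipartite graph. -/
def colorArray (c : (completeBipartiteGraph (Fin n) (Fin n)).lineGraph.Coloring α) :
    Matrix (Fin n) (Fin n) α :=
  fun i j => c ⟨s(Sum.inl i, Sum.inr j), cell_mem_edgeSet i j⟩

lemma exists_eq_cell (e : (completeBipartiteGraph (Fin n) (Fin n)).edgeSet) :
    ∃ i j, e = ⟨s(Sum.inl i, Sum.inr j), cell_mem_edgeSet i j⟩ := by
  obtain ⟨e, he⟩ := e
  induction e using Sym2.ind with
  | _ u v =>
    rcases u with i | i <;> rcases v with j | j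
    · simp at he
    · exact ⟨i, j, rfl⟩
    · exact ⟨j, i, Subtype.ext Sym2.eq_swap⟩
    · simp at he

lemma isLatinArray_colorArray
    (c : (completeBipartiteGraph (Fin n) (Fin n)).lineGraph.Coloring α) :
    IsLatinArray (colorArray c) := by
  refine ⟨fun i j j' h => ?_, fun j i i' h => ?_⟩
  · by_contra hne
    refine c.valid (v := ⟨s(Sum.inl i, Sum.inr j), cell_mem_edgeSet i j⟩)
      (w := ⟨s(Sum.inl i, Sum.inr j'), cell_mem_edgeSet i j'⟩) ?_ h
    rw [SimpleGraph.lineGraph_adj_iff_exists]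
    refine ⟨fun e => hne ?_, Sum.inl i, by simp⟩
    simpa using congrArg Subtype.val e
  · by_contra hne
    refine c.valid (v := ⟨s(Sum.inl i, Sum.inr j), cell_mem_edgeSet i j⟩)
      (w := ⟨s(Sum.inl i', Sum.inr j), cell_mem_edgeSet i' j⟩) ?_ h
    rw [SimpleGraph.lineGraph_adj_iff_exists]
    refine ⟨fun e => hne ?_, Sum.inr j, by simp⟩
    simpa using congrArg Subtype.val e

lemma arraySymbols_colorArray
    (c : (completeBipartiteGraph (Fin n) (Fin n)).lineGraph.Coloring α) :
    arraySymbols (colorArray c) = Set.range c := by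
  ext γ
  constructor
  · rintro ⟨p, rfl⟩
    exact ⟨_, rfl⟩
  · rintro ⟨e, rfl⟩
    obtain ⟨i, j, rfl⟩ := exists_eq_cell e
    exact ⟨(i, j), rfl⟩

/-- The spanning subgraph of the complete bipartite graph whose edges are the given cells. -/
def cellSubgraph (T : Set (Fin n × Fin n)) :
    (completeBipartiteGraph (Fin n) (Fin n)).Subgraph where
  verts := Set.univ
  Adj u v := ∃ p ∈ T, (u = Sum.inl p.1 ∧ v = Sum.inr p.2) ∨ (u = Sum.inr p.2 ∧ v = Sum.inl p.1)
  adj_sub := by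
    rintro u v ⟨p, -, ⟨rfl, rfl⟩ | ⟨rfl, rfl⟩⟩ <;> simp
  edge_vert _ := Set.mem_univ _
  symm := by
    refine ⟨?_⟩
    rintro u v ⟨p, hp, h⟩
    exact ⟨p, hp, by tauto⟩

lemma IsTransversal.isRainbowPerfectMatching
    {c : (completeBipartiteGraph (Fin n) (Fin n)).lineGraph.Coloring α} {T : Set (Fin n × Fin n)}
    (hT : IsTransversal (colorArray c) T) : IsRainbowPerfectMatching c (cellSubgraph T) := by
  obtain ⟨hrow, hcol, hinj⟩ := hT
  refine ⟨⟨?_, fun v => Set.mem_univ v⟩, ?_⟩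
  · rintro (i | j) -
    · obtain ⟨j, hj, huniq⟩ := hrow i
      refine ⟨Sum.inr j, ⟨(i, j), hj, Or.inl ⟨rfl, rfl⟩⟩, ?_⟩
      rintro v ⟨⟨i', j'⟩, hp, ⟨e, rfl⟩ | ⟨e, -⟩⟩
      · obtain rfl := Sum.inl_injective e
        rw [huniq j' hp]
      · exact absurd e (by simp)
    · obtain ⟨i, hi, huniq⟩ := hcol j
      refine ⟨Sum.inl i, ⟨(i, j), hi, Or.inr ⟨rfl, rfl⟩⟩, ?_⟩
      rintro v ⟨⟨i', j'⟩, hp, ⟨e, -⟩ | ⟨e, rfl⟩⟩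
      · exact absurd e (by simp)
      · obtain rfl := Sum.inr_injective e
        rw [huniq i' hp]
  · have hmem : ∀ i j, s(Sum.inl i, Sum.inr j) ∈ (cellSubgraph T).edgeSet → (i, j) ∈ T := by
      rintro i j ⟨⟨i', j'⟩, hp, ⟨e, e'⟩ | ⟨e, -⟩⟩
      · obtain rfl := Sum.inl_injective e
        obtain rfl := Sum.inr_injective e'
        exact hp
      · exact absurd e (by simp)
    intro e he e' he' h
    obtain ⟨i, j, rfl⟩ := exists_eq_cell e
    obtain ⟨i', j', rfl⟩ := exists_eq_cell e'
    have := hinj (hmem i j he) (hmem i' j' he') h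
    rw [Prod.mk.injEq] at this
    obtain ⟨rfl, rfl⟩ := this
    rfl

end Bipartite

/-! ### Large orders and the conclusion. -/

lemma exists_large_order :
    ∃ N : ℕ, ∀ n : ℕ, N ≤ n → 0 < n ∧ (n : ℝ) ^ (-(1 / 200) : ℝ) ≤ 1 / 2 ∧
      10 ^ 8 ≤ n * (((n : ℝ) ^ (-(1 / 200) : ℝ)) ^ 2 / 64000) ^ 12 := by
  have h1 : ∀ᶠ n : ℕ in Filter.atTop, (n : ℝ) ^ (-(1 / 200) : ℝ) ≤ 1 / 2 :=
    ((tendsto_rpow_neg_atTop (by norm_num : (0 : ℝ) < 1 / 200)).comp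
      tendsto_natCast_atTop_atTop).eventually (ge_mem_nhds (by norm_num))
  have h2 : ∀ᶠ n : ℕ in Filter.atTop, (10 ^ 8 * 64000 ^ 12 : ℝ) ≤ (n : ℝ) ^ (22 / 25 : ℝ) :=
    ((tendsto_rpow_atTop (by norm_num : (0 : ℝ) < 22 / 25)).comp
      tendsto_natCast_atTop_atTop).eventually_ge_atTop _
  obtain ⟨N, hN⟩ := Filter.eventually_atTop.1 ((Filter.eventually_gt_atTop 0).and (h1.and h2))
  refine ⟨N, fun n hn => ?_⟩
  obtain ⟨hpos, h3, h4⟩ := hN n hn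
  refine ⟨hpos, h3, ?_⟩
  have hpos' : (0 : ℝ) < n := Nat.cast_pos.2 hpos
  -- The exponent is 1 − 24/200 = 22/25; its positivity is what makes density n^(−1/200) admissible.
  have h5 : (n : ℝ) * (((n : ℝ) ^ (-(1 / 200) : ℝ)) ^ 2 / 64000) ^ 12 =
      (n : ℝ) ^ (22 / 25 : ℝ) / 64000 ^ 12 := by
    rw [div_pow, ← pow_mul, ← Real.rpow_natCast, ← Real.rpow_mul hpos'.le, mul_div_assoc']
    congr 1
    nth_rewrite 1 [← Real.rpow_one (n : ℝ)]
    rw [← Real.rpow_add hpos']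
    norm_num
  rw [h5, le_div_iff₀ (by positivity)]
  exact h4

end RainbowMatchings

theorem theorem1 :
    ∃ N : ℕ, ∀ n : ℕ, N ≤ n → ∀ α : Type*,
      -- rainbow perfect matchings in properly edge-coloured complete bipartite graphs
      (∀ d : ℝ, (n : ℝ) ^ (-(1 / 200) : ℝ) < d →
        ∀ c : (completeBipartiteGraph (Fin n) (Fin n)).lineGraph.Coloring α,
          d * (n : ℝ) ^ 2 ≤ ((Set.range c).ncard : ℝ) →
            ∃ M : (completeBipartiteGraph (Fin n) (Fin n)).Subgraph,
              IsRainbowPerfectMatching c M) ∧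
      -- transversals in Latin arrays
      (∀ L : Matrix (Fin n) (Fin n) α, IsLatinArray L →
        (n : ℝ) ^ (399 / 200 : ℝ) ≤ ((arraySymbols L).ncard : ℝ) →
          ∃ T, IsTransversal L T) ∧
      -- in particular, the Akbari–Alipour conjecture for large orders
      (∀ L : Matrix (Fin n) (Fin n) α, IsLatinArray L →
        (n : ℝ) ^ 2 / 2 ≤ ((arraySymbols L).ncard : ℝ) →
          ∃ T, IsTransversal L T) := by
  obtain ⟨N, hN⟩ := exists_large_order
  refine ⟨N, fun n hn α => ?_⟩
  obtain ⟨hpos, hhalf, hlarge⟩ := hN n hn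
  set d₀ : ℝ := (n : ℝ) ^ (-(1 / 200) : ℝ) with hd₀
  have hpos' : (0 : ℝ) < n := Nat.cast_pos.2 hpos
  have hd₀pos : 0 < d₀ := Real.rpow_pos_of_pos hpos' _
  have main : ∀ L : Matrix (Fin n) (Fin n) α, IsLatinArray L →
      d₀ * (n : ℝ) ^ 2 ≤ ((arraySymbols L).ncard : ℝ) → ∃ T, IsTransversal L T :=
    fun L hL h => hL.exists_isTransversal hd₀pos (by linarith) hlarge h
  refine ⟨fun d hd c hc => ?_, fun L hL h => main L hL ?_, fun L hL h => main L hL ?_⟩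
  -- The given d may exceed 1, so it is lowered to d₀, for which the size conditions hold.
  · obtain ⟨T, hT⟩ := main (colorArray c) (isLatinArray_colorArray c) (by
      rw [arraySymbols_colorArray]
      exact (mul_le_mul_of_nonneg_right hd.le (by positivity)).trans hc)
    exact ⟨cellSubgraph T, hT.isRainbowPerfectMatching⟩
  · refine le_trans (le_of_eq ?_) h
    rw [hd₀, ← Real.rpow_natCast, ← Real.rpow_add hpos']
    norm_num
  · refine le_trans ?_ h
    have : (0 : ℝ) ≤ (n : ℝ) ^ 2 := by positivity
    nlinarith
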